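/- **Theorem (Q-aggregation, Gaussian setting).** There is an absolute constant $C>0$ such that the following holds. Let $d,B\ge 1$ and $N_1,\dots,N_B\ge 1$ be integers, let $\mu_1,\dots,\mu_B\in\mathbb R^d$, and let $\Sigma_1,\dots,\Sigma_B$ be symmetric positive semidefinite $d\times d$ matrices with $\Sigma_1\neq 0$. Let $X^{(k)}_i$ ($1\le k\le B$, $1\le i\le N_k$) be jointly independent random vectors with $X^{(k)}_i\sim\mathcal N(\mu_k,\Sigma_k)$. Write $\hat\mu_k=\frac1{N_k}\sum_{i=1}^{N_k}X^{(k)}_i$ for the empirical means, $\mathcal S_B=\{\omega\in[0,1]^B:\sum_{k}\omega_k=1\}$ for the simplex, $\hat\mu_\omega=\sum_{k=1}^B\omega_k\hat\mu_k$ for $\omega\in\mathcal S_B$, and $$s_1^2=\mathbb E\|\hat\mu_1-\mu_1\|^2=\frac{\operatorname{Tr}\Sigma_1}{N_1},\qquad d_1^\bullet=\frac{(\operatorname{Tr}\Sigma_1)^2}{\operatorname{Tr}(\Sigma_1^2)} .$$ For a fixed or data-dependent weight vector $\omega$ with values in $\mathcal S_B$ let $R_1(\omega)=\mathbb E\|\hat\mu_\omega-\mu_1\|^2$.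 Put $$\hat s_1^2=\frac1{N_1(N_1-1)}\sum_{i=1}^{N_1}\|X^{(1)}_i-\hat\mu_1\|^2,\qquad \hat q_k=\frac1{N_1-1}\sum_{i=1}^{N_1}\langle\hat\mu_1-\hat\mu_k,\,X^{(1)}_i-\hat\mu_1\rangle^2,$$ $$\hat L_1(\omega)=\Big\|\sum_{k=2}^B\omega_k(\hat\mu_k-\hat\mu_1)\Big\|^2+(2\omega_1-1)\hat s_1^2,\qquad \hat Q_1(\omega)=\sum_{k=2}^B\omega_k\sqrt{\hat q_k/N_1},$$ and, with $\Delta_k=\mu_k-\mu_1$, $$Q_1(\omega)=\sum_{k=2}^B\omega_k\sqrt{\frac{q_k}{N_1}},\qquad q_k=\Delta_k^T\Sigma_1\Delta_k+\frac{\operatorname{Tr}(\Sigma_1\Sigma_k)}{N_k}.$$ Let $u_0$ be a real number with $\log(17B)\le u_0\le (N_1-1)/2$, and let $\hat\omega$ be a (measurable) random weight vector with $$\hat\omega\in\arg\min_{\omega\in\mathcal S_B}\Big(\hat L_1(\omega)+16\sqrt{u_0}\,\hat Q_1(\omega)\Big)\quad\text{almost surely.}$$ Then $\|\hat\mu_{\hat\omega}-\mu_1\|^2$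 is integrable and $$\frac{R_1(\hat\omega)}{s_1^2}\le\frac1{s_1^2}\min_{\omega\in\mathcal S_B}\Big[R_1(\omega)\big(1+CBe^{-u_0/2}\big)+C\,Q_1(\omega)\sqrt{u_0}\Big]+C\,\frac{u_0}{\sqrt{d_1^\bullet}},$$ where the minimum, over deterministic weight vectors, is attained. -/

import Mathlib

open MeasureTheory ProbabilityTheory
open scoped Matrix

noncomputable section

namespace QAggregation

/-- A data set: for each task `k` (an element of `Fin B`; the target task is `0`), a bag of `N k`
vectors of `ℝ^d`. -/
abbrev Dataset (d B : ℕ) (N : Fin B → ℕ) : Type :=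
  (k : Fin B) → Fin (N k) → EuclideanSpace ℝ (Fin d)

section Estimators

variable {d B : ℕ} {N : Fin B → ℕ}

/-- The naive estimator of task `k`: the empirical mean of its bag. -/
def naive (x : Dataset d B N) (k : Fin B) : EuclideanSpace ℝ (Fin d) :=
  (1 / (N k : ℝ)) • ∑ i, x k i

/-- The aggregation estimator with weight vector `w`. -/
def aggregate (x : Dataset d B N) (w : Fin B → ℝ) : EuclideanSpace ℝ (Fin d) :=
  ∑ k, w k • naive x k

variable [NeZero B]

/-- The unbiased estimator of the naive risk of the target task. -/
def naiveRiskHat (x : Dataset d B N) : ℝ :=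
  1 / ((N 0 : ℝ) * ((N 0 : ℝ) - 1)) * ∑ i, ‖x 0 i - naive x 0‖ ^ 2

/-- The empirical risk `L̂₁(w)`. -/
def lossHat (x : Dataset d B N) (w : Fin B → ℝ) : ℝ :=
  ‖∑ k ∈ Finset.univ.erase 0, w k • (naive x k - naive x 0)‖ ^ 2
    + (2 * w 0 - 1) * naiveRiskHat x

/-- `q̂ₖ`. -/
def qHat (x : Dataset d B N) (k : Fin B) : ℝ :=
  1 / ((N 0 : ℝ) - 1) * ∑ i, (inner ℝ (naive x 0 - naive x k) (x 0 i - naive x 0)) ^ 2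

/-- The empirical penalty `Q̂₁(w)`. -/
def penaltyHat (x : Dataset d B N) (w : Fin B → ℝ) : ℝ :=
  ∑ k ∈ Finset.univ.erase 0, w k * √(qHat x k / (N 0 : ℝ))

/-- The penalised criterion whose minimiser over the simplex gives the aggregation weights. -/
def criterion (u₀ : ℝ) (x : Dataset d B N) (w : Fin B → ℝ) : ℝ :=
  lossHat x w + 16 * √u₀ * penaltyHat x w

/-- `w` is a minimiser of the penalised criterion over the simplex. -/
def IsQAggregationWeight (u₀ : ℝ) (x : Dataset d B N) (w : Fin B → ℝ) : Prop :=
  w ∈ stdSimplex ℝ (Fin B) ∧ ∀ v ∈ stdSimplex ℝ (Fin B), criterion u₀ x w ≤ criterion u₀ x v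

end Estimators

/-- The quadratic risk `E ‖μ̂ - m‖²` of an estimator `μ̂` of the vector `m`. -/
def risk {Ω : Type*} [MeasurableSpace Ω] (P : Measure Ω) {d : ℕ}
    (est : Ω → EuclideanSpace ℝ (Fin d)) (m : EuclideanSpace ℝ (Fin d)) : ℝ :=
  ∫ a, ‖est a - m‖ ^ 2 ∂P

/-- The naive risk `s₁²` of the target task: the risk of its empirical mean. -/
def naiveRisk {Ω : Type*} [MeasurableSpace Ω] (P : Measure Ω) {d B : ℕ} [NeZero B]
    {N : Fin B → ℕ} (X : (k : Fin B) → Fin (N k) → Ω → EuclideanSpace ℝ (Fin d))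
    (m : EuclideanSpace ℝ (Fin d)) : ℝ :=
  risk P (fun a => naive (fun k i => X k i a) 0) m

/-- The risk for the target mean `m` of the aggregation estimator with the (possibly random)
weights `w`. -/
def aggRisk {Ω : Type*} [MeasurableSpace Ω] (P : Measure Ω) {d B : ℕ}
    {N : Fin B → ℕ} (X : (k : Fin B) → Fin (N k) → Ω → EuclideanSpace ℝ (Fin d))
    (m : EuclideanSpace ℝ (Fin d)) (w : Ω → Fin B → ℝ) : ℝ :=
  risk P (fun a => aggregate (fun k i => X k i a) (w a)) m

/-- `qₖ = Δₖᵀ Σ₁ Δₖ + Tr(Σ₁ Σₖ) / Nₖ` with `Δₖ = μₖ - μ₁`. -/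
def q {d B : ℕ} [NeZero B] (N : Fin B → ℕ) (μ : Fin B → EuclideanSpace ℝ (Fin d))
    (S : Fin B → Matrix (Fin d) (Fin d) ℝ) (k : Fin B) : ℝ :=
  (μ k - μ 0).ofLp ⬝ᵥ (S 0 *ᵥ (μ k - μ 0).ofLp) + (S 0 * S k).trace / (N k : ℝ)

/-- The penalty `Q₁(w)`. -/
def penalty {d B : ℕ} [NeZero B] (N : Fin B → ℕ) (μ : Fin B → EuclideanSpace ℝ (Fin d))
    (S : Fin B → Matrix (Fin d) (Fin d) ℝ) (w : Fin B → ℝ) : ℝ :=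
  ∑ k ∈ Finset.univ.erase 0, w k * √(q N μ S k / (N 0 : ℝ))

/-- The effective dimension `d• = (Tr A)² / Tr A²` of a covariance matrix. -/
def effDim {d : ℕ} (A : Matrix (Fin d) (Fin d) ℝ) : ℝ :=
  A.trace ^ 2 / (A * A).trace

/-- The function of a deterministic weight vector `w` that the oracle minimises:
`R₁(w) (1 + C B exp(-u₀/2)) + C Q₁(w) √u₀`. -/
def oracleBound {Ω : Type*} [MeasurableSpace Ω] (P : Measure Ω) {d B : ℕ} [NeZero B]
    {N : Fin B → ℕ} (X : (k : Fin B) → Fin (N k) → Ω → EuclideanSpace ℝ (Fin d))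
    (μ : Fin B → EuclideanSpace ℝ (Fin d)) (S : Fin B → Matrix (Fin d) (Fin d) ℝ)
    (C u₀ : ℝ) (w : Fin B → ℝ) : ℝ :=
  aggRisk P X (μ 0) (fun _ => w) * (1 + C * (B : ℝ) * Real.exp (-u₀ / 2))
    + C * penalty N μ S w * √u₀

end QAggregation

end

/-!
Expanding the square shows that the loss `‖aggregate x w - μ 0‖ ^ 2` is the empirical risk
`lossHat x w` plus `(2 * w 0 - 1)` times the error of `naiveRiskHat`, plus the noise term
`2 ⟨e, Z⟩`, where `e` is the error of the target mean and `Z = ∑ k ≠ 0, w k • (naive x k - μ 0)`.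
Comparing the criterion at the selected weights and at fixed weights `w` gives, for every data set,
the oracle inequality `loss_le`. Apart from the noise at the selected weights, every error term in
it involves fixed weights only, so its mean is computed by second moments: `naiveRiskHat` differs
from `‖e‖ ^ 2` by a degenerate U-statistic (`integral_abs_norm_sq_sub_le`), and the penalty and the
noise at `w` are integrated by conditioning, the other tasks being independent of the target sample.

The noise at the selected weights is the delicate term, because these weights depend on `e`. A
deviation inequality holding up to an event would not suffice: the loss on the exceptional event has
to be compared with the risk, uniformly in the unbounded vectors `naive x k - μ 0`. Instead, the
penalty absorbs the noise up to `η * ‖Z‖ ^ 2` plus a remainder, `noiseExcess`. The vectors `x` such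
that `⟨x, A* V k⟩` stays below its penalty level for every `k`, with `V k` the deviations and `A`
the square root of the covariance, form a closed convex set. For `x` in this set the noise is below
the penalty for every convex combination, and for other `x` it exceeds the penalty by at most the
distance of `x` to the set times `‖A* Z‖`, which Young's inequality turns into `η * ‖Z‖ ^ 2` plus a
multiple of the squared distance (`exists_noise_bound`).

The mean squared distance of a standard Gaussian vector to a closed convex set of mass at least one
half is at most a constant times the missing mass (`integral_sq_dist_convex_le`): the function
`φ = dist ^ 2 / 2` satisfies `‖∇φ‖ ^ 2 = 2 φ`, so a Poincaré-type inequality bounds its second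
moment by its mean, and Cauchy–Schwarz on the complement of the set concludes. The missing mass is at
most `B * exp (-u)` by a union bound; the choice `η = B * exp (-u)` makes the remainder of the order
of the Frobenius norm of the covariance divided by `N 0`. The levels use empirical variances of the
target sample, which is independent of its mean; directions whose variance is badly underestimated
have probability at most `exp (-u)` (`measure_sampleVar_lt_le`) and are projected out.
-/

namespace QAggregation

set_option linter.unusedSectionVars false

/-! ### The squared distance to a closed convex set -/

section Projection

variable {E : Type*} [NormedAddCommGroup E] [InnerProductSpace ℝ E]

/-- `p` is the metric projection onto `K`, described by its variational inequality. -/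
structure IsConvexProj (K : Set E) (p : E → E) : Prop where
  mem : ∀ x, p x ∈ K
  inner_le : ∀ x, ∀ w ∈ K, inner ℝ (x - p x) (w - p x) ≤ 0

lemma exists_isConvexProj [CompleteSpace E] {K : Set E} (hne : K.Nonempty) (hcl : IsClosed K)
    (hcv : Convex ℝ K) : ∃ p : E → E, IsConvexProj K p := by
  choose p hp hmin using exists_norm_eq_iInf_of_complete_convex hne hcl.isComplete hcv
  exact ⟨p, hp, fun x => (norm_eq_iInf_iff_real_inner_le_zero hcv (hp x)).1 (hmin x)⟩

namespace IsConvexProj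

variable {K : Set E} {p : E → E} (hp : IsConvexProj K p)
include hp

lemma norm_sub_sq_le (x w : E) (hw : w ∈ K) : ‖x - p x‖ ^ 2 ≤ ‖x - w‖ ^ 2 := by
  have h := hp.inner_le x w hw
  have e : x - w = (x - p x) - (w - p x) := by abel
  rw [e, norm_sub_sq_real (x - p x) (w - p x)]
  nlinarith [sq_nonneg ‖w - p x‖]

lemma eq_self {x : E} (hx : x ∈ K) : p x = x := by
  have h := hp.norm_sub_sq_le x x hx
  simp only [sub_self, norm_zero, ne_eq, OfNat.ofNat_ne_zero, not_false_eq_true, zero_pow] at h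
  have h0 := pow_eq_zero_iff (two_ne_zero) |>.1 (le_antisymm h (sq_nonneg _))
  exact (norm_sub_eq_zero_iff.1 h0).symm

lemma norm_sub_sq_le_inner (x y : E) : ‖p x - p y‖ ^ 2 ≤ inner ℝ (p x - p y) (x - y) := by
  have h1 := hp.inner_le x (p y) (hp.mem y)
  have h2 := hp.inner_le y (p x) (hp.mem x)
  rw [← real_inner_self_eq_norm_sq]
  simp only [inner_sub_left, inner_sub_right] at *
  have := real_inner_comm x (p x)
  have := real_inner_comm x (p y)
  have := real_inner_comm y (p x)
  have := real_inner_comm y (p y)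
  have := real_inner_comm (p y) (p x)
  linarith

lemma norm_proj_sub_le (x y : E) : ‖p x - p y‖ ≤ ‖x - y‖ := by
  have h := (hp.norm_sub_sq_le_inner x y).trans (real_inner_le_norm _ _)
  by_contra! hc
  nlinarith [norm_nonneg (x - y), norm_nonneg (p x - p y)]

lemma continuous : Continuous p :=
  (LipschitzWith.of_dist_le_mul (K := 1) fun x y => by
    simpa [dist_eq_norm] using hp.norm_proj_sub_le x y).continuous

lemma half_sq_le (x y : E) : ‖y - p y‖ ^ 2 / 2
    ≤ ‖x - p x‖ ^ 2 / 2 + inner ℝ (x - p x) (y - x) + ‖y - x‖ ^ 2 / 2 := by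
  have h := hp.norm_sub_sq_le y (p x) (hp.mem x)
  have e : y - p x = (x - p x) + (y - x) := by abel
  rw [e, norm_add_sq_real] at h
  linarith

/-- Half the squared distance to `K` is differentiable and its gradient at `x` is `x - p x`: it lies
within `‖y - x‖² / 2` of its linearisation because the projection is monotone and nonexpansive. -/
lemma hasFDerivAt (x : E) :
    HasFDerivAt (fun x => ‖x - p x‖ ^ 2 / 2) (innerSL ℝ (x - p x)) x := by
  rw [hasFDerivAt_iff_isLittleO]
  refine Asymptotics.IsBigO.trans_isLittleO (g := fun y => ‖y - x‖ ^ 2) ?_ ?_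
  · refine Asymptotics.IsBigO.of_bound 1 (Filter.Eventually.of_forall fun y => ?_)
    have h1 := hp.half_sq_le x y
    have h2 := hp.half_sq_le y x
    have h3 := hp.norm_proj_sub_le y x
    have h4 := real_inner_le_norm (p y - p x) (y - x)
    have h5 : ‖p y - p x‖ * ‖y - x‖ ≤ ‖y - x‖ ^ 2 := by
      rw [sq]; gcongr
    have e : inner ℝ (y - p y) (x - y)
        = - inner ℝ (x - p x) (y - x) - ‖y - x‖ ^ 2 + inner ℝ (p y - p x) (y - x) := by
      rw [← real_inner_self_eq_norm_sq]
      simp only [inner_sub_left, inner_sub_right]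
      ring
    rw [e, norm_sub_rev x y] at h2
    simp only [innerSL_apply_apply, norm_pow, one_mul, Real.norm_eq_abs, abs_norm]
    rw [abs_le]
    constructor <;> nlinarith [sq_nonneg ‖y - x‖]
  · have := (Asymptotics.isLittleO_norm_pow_id (E' := E) (n := 2) (by norm_num))
    have h2 := this.comp_tendsto (k := fun y => y - x) (l' := nhds x)
      (by simpa using (Filter.tendsto_id (α := E) (x := nhds x)).sub_const x)
    simpa [Function.comp_def] using h2

end IsConvexProj

end Projection

/-! ### Gaussian measure of a convex set and the distance to it -/

section Concentration

variable {E : Type*} [NormedAddCommGroup E] [InnerProductSpace ℝ E] [FiniteDimensional ℝ E]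
  [MeasurableSpace E] [BorelSpace E]

lemma lintegral_inner_sq_stdGaussian (v : E) :
    ∫⁻ y, ENNReal.ofReal (inner ℝ v y ^ 2) ∂(stdGaussian E) = ENNReal.ofReal (‖v‖ ^ 2) := by
  have hv := variance_dual_stdGaussian (innerSL ℝ v)
  have hm : MemLp (innerSL ℝ v) 2 (stdGaussian E) := IsGaussian.memLp_dual _ _ _ (by simp)
  rw [variance_eq_sub hm, integral_strongDual_stdGaussian] at hv
  simp only [innerSL_apply_norm, Pi.pow_apply, innerSL_apply_apply] at hv
  have hi : Integrable (fun y => inner ℝ v y ^ 2) (stdGaussian E) := hm.integrable_sq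
  rw [← ofReal_integral_eq_lintegral_ofReal hi
    (Filter.Eventually.of_forall fun _ => sq_nonneg _)]
  congr 1
  simpa using hv

lemma sq_intervalIntegral_le {f : ℝ → ℝ} (hf : Continuous f) {L : ℝ} (hL : 0 < L) :
    (∫ t in (0)..L, f t) ^ 2 ≤ L * ∫ t in (0)..L, f t ^ 2 := by
  set I := ∫ t in (0)..L, f t with hI
  have h0 : 0 ≤ ∫ t in (0)..L, (f t - I / L) ^ 2 :=
    intervalIntegral.integral_nonneg hL.le fun _ _ => sq_nonneg _
  have e : ∫ t in (0)..L, (f t - I / L) ^ 2 = (∫ t in (0)..L, f t ^ 2) - I ^ 2 / L := by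
    have : ∀ t, (f t - I / L) ^ 2 = f t ^ 2 - (2 * (I / L)) * f t + (I / L) ^ 2 := fun t => by ring
    simp_rw [this]
    rw [intervalIntegral.integral_add, intervalIntegral.integral_sub,
      intervalIntegral.integral_const_mul, ← hI]
    · simp; field_simp; ring
    all_goals exact Continuous.intervalIntegrable (by fun_prop) _ _
  rw [e, sub_nonneg, div_le_iff₀ hL] at h0
  linarith

/-- The interpolation inequality: for independent standard Gaussian vectors `x`, `y`, integrate the
derivative of `φ` along the rotation path from `x` to `y`; at each angle the position and the
velocity are again independent standard Gaussian vectors. -/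
lemma lintegral_sub_sq_le {φ : E → ℝ} {g : E → E} (hg : Continuous g)
    (hφ : ∀ x, HasFDerivAt φ (innerSL ℝ (g x)) x) :
    ∫⁻ z, ENNReal.ofReal ((φ z.2 - φ z.1) ^ 2) ∂((stdGaussian E).prod (stdGaussian E))
      ≤ ENNReal.ofReal (Real.pi ^ 2 / 4) *
        ∫⁻ x, ENNReal.ofReal (‖g x‖ ^ 2) ∂(stdGaussian E) := by
  set γ := stdGaussian E with hγ
  set f : ℝ → E × E → ℝ := fun t z => inner ℝ (g (ContinuousLinearMap.rotation t z).1)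
    (ContinuousLinearMap.rotation t z).2 with hf
  have hfc : Continuous (fun p : ℝ × (E × E) => f p.1 p.2) := by
    simp only [hf, ContinuousLinearMap.rotation_apply]
    fun_prop
  have hpi : 0 < Real.pi / 2 := by positivity
  have hpath : ∀ z : E × E, φ z.2 - φ z.1 = ∫ t in (0)..(Real.pi / 2), f t z := by
    intro z
    have hder : ∀ t ∈ Set.uIcc 0 (Real.pi / 2),
        HasDerivAt (fun t => φ (ContinuousLinearMap.rotation t z).1) (f t z) t := by
      intro t _
      have h1 : HasDerivAt (fun t => (ContinuousLinearMap.rotation t z).1)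
          (ContinuousLinearMap.rotation t z).2 t := by
        simp only [ContinuousLinearMap.rotation_apply]
        exact ((Real.hasDerivAt_cos t).smul_const z.1).add ((Real.hasDerivAt_sin t).smul_const z.2)
      exact (hφ _).comp_hasDerivAt t h1
    rw [intervalIntegral.integral_eq_sub_of_hasDerivAt hder
      (Continuous.intervalIntegrable (by fun_prop) _ _)]
    simp [ContinuousLinearMap.rotation_apply]
  have hbound : ∀ z : E × E, ENNReal.ofReal ((φ z.2 - φ z.1) ^ 2) ≤
      ENNReal.ofReal (Real.pi / 2) *
        ∫⁻ t in Set.Ioc 0 (Real.pi / 2), ENNReal.ofReal (f t z ^ 2) := by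
    intro z
    have hc : Continuous fun t => f t z := by fun_prop
    rw [hpath z, ← ofReal_integral_eq_lintegral_ofReal, ← ENNReal.ofReal_mul hpi.le,
      ← intervalIntegral.integral_of_le hpi.le]
    · exact ENNReal.ofReal_le_ofReal (sq_intervalIntegral_le hc hpi)
    · exact ((hc.pow 2).continuousOn.integrableOn_Icc).mono_set Set.Ioc_subset_Icc_self
    · exact Filter.Eventually.of_forall fun _ => sq_nonneg _
  have hrot : ∀ t, ∫⁻ z, ENNReal.ofReal (f t z ^ 2) ∂(γ.prod γ)
      = ∫⁻ x, ENNReal.ofReal (‖g x‖ ^ 2) ∂γ := by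
    intro t
    have hmeas : Measurable fun z : E × E => ENNReal.ofReal (inner ℝ (g z.1) z.2 ^ 2) := by
      have : Continuous fun z : E × E => inner ℝ (g z.1) z.2 ^ 2 := by fun_prop
      exact this.measurable.ennreal_ofReal
    have hinv : (γ.prod γ).map (ContinuousLinearMap.rotation t) = γ.prod γ :=
      IsGaussian.map_rotation_eq_self (by simp [hγ]) t
    calc ∫⁻ z, ENNReal.ofReal (f t z ^ 2) ∂(γ.prod γ)
        = ∫⁻ z, ENNReal.ofReal (inner ℝ (g z.1) z.2 ^ 2)
            ∂((γ.prod γ).map (ContinuousLinearMap.rotation t)) := by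
          rw [lintegral_map hmeas (by fun_prop)]
      _ = ∫⁻ x, ∫⁻ y, ENNReal.ofReal (inner ℝ (g x) y ^ 2) ∂γ ∂γ := by
          rw [hinv, lintegral_prod _ hmeas.aemeasurable]
      _ = _ := by simp_rw [hγ, lintegral_inner_sq_stdGaussian]
  have hfm : Measurable (fun p : (E × E) × ℝ => ENNReal.ofReal (f p.2 p.1 ^ 2)) := by
    have : Continuous (fun p : (E × E) × ℝ => f p.2 p.1 ^ 2) := by fun_prop
    exact this.measurable.ennreal_ofReal
  calc ∫⁻ z, ENNReal.ofReal ((φ z.2 - φ z.1) ^ 2) ∂(γ.prod γ)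
      ≤ ∫⁻ z, (ENNReal.ofReal (Real.pi / 2) *
        ∫⁻ t in Set.Ioc 0 (Real.pi / 2), ENNReal.ofReal (f t z ^ 2)) ∂(γ.prod γ) :=
        lintegral_mono hbound
    _ = ENNReal.ofReal (Real.pi / 2) * ∫⁻ t in Set.Ioc 0 (Real.pi / 2),
        ∫⁻ z, ENNReal.ofReal (f t z ^ 2) ∂(γ.prod γ) := by
        rw [lintegral_const_mul' _ _ ENNReal.ofReal_ne_top,
          lintegral_lintegral_swap (f := fun z t => ENNReal.ofReal (f t z ^ 2))]
        exact hfm.aemeasurable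
    _ = _ := by
        simp_rw [hrot]
        rw [lintegral_const, Measure.restrict_apply MeasurableSet.univ, Set.univ_inter,
          Real.volume_Ioc, sub_zero, mul_comm (∫⁻ x, _ ∂γ), ← mul_assoc,
          ← ENNReal.ofReal_mul hpi.le]
        congr 2
        ring

/-- If a closed convex set carries at least half of the Gaussian mass, the mean squared distance to
it is at most a constant multiple of the mass it misses. -/
lemma integral_sq_dist_convex_le {K : Set E} (hcl : IsClosed K) {p : E → E}
    (hp : IsConvexProj K p) (hK : 1 / 2 ≤ (stdGaussian E).real K) :
    Integrable (fun x => ‖x - p x‖ ^ 2) (stdGaussian E) ∧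
    ∫ x, ‖x - p x‖ ^ 2 ∂(stdGaussian E) ≤ 10 * (stdGaussian E).real Kᶜ := by
  set γ := stdGaussian E with hγ
  set φ : E → ℝ := fun x => ‖x - p x‖ ^ 2 / 2 with hφ
  have hpc := hp.continuous
  have hφc : Continuous φ := by simp only [hφ]; fun_prop
  have hφ0 : ∀ x, 0 ≤ φ x := fun x => by simp only [hφ]; positivity
  have hφK : ∀ x ∈ K, φ x = 0 := fun x hx => by simp [hφ, hp.eq_self hx]
  have hm : MemLp (fun x : E => x - p x) 4 γ := by
    refine MemLp.mono' (g := fun x => ‖x - p 0‖) ?_ (by fun_prop)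
      (Filter.Eventually.of_forall fun x => ?_)
    · exact ((IsGaussian.memLp_id γ 4 (by simp)).sub (memLp_const (p 0))).norm
    · exact (sq_le_sq₀ (norm_nonneg _) (norm_nonneg _)).1 (hp.norm_sub_sq_le x (p 0) (hp.mem 0))
  have h2 : Integrable (fun x => ‖x - p x‖ ^ 2) γ :=
    (hm.mono_exponent (p := 2) (by norm_num)).integrable_norm_pow (by norm_num)
  have h4 : Integrable (fun x => φ x ^ 2) γ := by
    have := (hm.integrable_norm_pow (p := 4) (by norm_num)).const_mul (1 / 4)
    refine this.congr (Filter.Eventually.of_forall fun x => ?_)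
    simp only [hφ]; ring
  have h1 : Integrable φ γ := h2.div_const 2
  refine ⟨h2, ?_⟩
  -- Poincaré-type inequality for `φ`, whose gradient has squared norm `2 φ`
  have hP := lintegral_sub_sq_le (φ := φ) (g := fun x => x - p x) (by fun_prop) hp.hasFDerivAt
  rw [← hγ, ← ofReal_integral_eq_lintegral_ofReal h2
    (Filter.Eventually.of_forall fun x => sq_nonneg _)] at hP
  have hKm : MeasurableSet K := hcl.measurableSet
  -- pairs with exactly one point in `K` bound the left side from below
  have hlow : ENNReal.ofReal (2 * γ.real K * ∫ x, φ x ^ 2 ∂γ) ≤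
      ∫⁻ z, ENNReal.ofReal ((φ z.2 - φ z.1) ^ 2) ∂(γ.prod γ) := by
    have e1 : ∫⁻ x in K, ∫⁻ y in Kᶜ, ENNReal.ofReal (φ y ^ 2) ∂γ ∂γ
        = ENNReal.ofReal (γ.real K * ∫ x, φ x ^ 2 ∂γ) := by
      rw [lintegral_const, Measure.restrict_apply MeasurableSet.univ, Set.univ_inter, mul_comm,
        ENNReal.ofReal_mul measureReal_nonneg, ofReal_measureReal,
        ofReal_integral_eq_lintegral_ofReal h4 (Filter.Eventually.of_forall fun x => sq_nonneg _)]
      congr 1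
      rw [← lintegral_add_compl (μ := γ) _ hKm, setLIntegral_congr_fun (g := fun _ => 0) hKm]
      · simp
      · intro x hx; simp [hφK x hx]
    have hmeas : Measurable fun z : E × E => ENNReal.ofReal ((φ z.2 - φ z.1) ^ 2) := by
      have : Continuous fun z : E × E => (φ z.2 - φ z.1) ^ 2 := by fun_prop
      exact this.measurable.ennreal_ofReal
    have hA : ENNReal.ofReal (γ.real K * ∫ x, φ x ^ 2 ∂γ) ≤
        ∫⁻ z in K ×ˢ Kᶜ, ENNReal.ofReal ((φ z.2 - φ z.1) ^ 2) ∂(γ.prod γ) := by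
      rw [setLIntegral_prod _ hmeas.aemeasurable, ← e1]
      refine setLIntegral_mono_ae' hKm (Filter.Eventually.of_forall fun x hx => ?_)
      simp [hφK x hx]
    have hB : ENNReal.ofReal (γ.real K * ∫ x, φ x ^ 2 ∂γ) ≤
        ∫⁻ z in Kᶜ ×ˢ K, ENNReal.ofReal ((φ z.2 - φ z.1) ^ 2) ∂(γ.prod γ) := by
      rw [← Measure.prod_restrict, lintegral_prod_symm _ hmeas.aemeasurable, ← e1]
      refine setLIntegral_mono_ae' hKm (Filter.Eventually.of_forall fun x hx => ?_)
      simp [hφK x hx]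
    have hdisj : Disjoint (K ×ˢ Kᶜ) (Kᶜ ×ˢ K) := by
      rw [Set.disjoint_left]; rintro ⟨a, b⟩ ⟨ha, _⟩ ⟨ha', _⟩; exact ha' ha
    have h0 : 0 ≤ γ.real K * ∫ x, φ x ^ 2 ∂γ :=
      mul_nonneg measureReal_nonneg (integral_nonneg fun _ => sq_nonneg _)
    calc ENNReal.ofReal (2 * γ.real K * ∫ x, φ x ^ 2 ∂γ)
        = ENNReal.ofReal (γ.real K * ∫ x, φ x ^ 2 ∂γ)
          + ENNReal.ofReal (γ.real K * ∫ x, φ x ^ 2 ∂γ) := by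
          rw [← ENNReal.ofReal_add h0 h0]; congr 1; ring
      _ ≤ _ := add_le_add hA hB
      _ = ∫⁻ z in (K ×ˢ Kᶜ) ∪ (Kᶜ ×ˢ K), ENNReal.ofReal ((φ z.2 - φ z.1) ^ 2) ∂(γ.prod γ) := by
          rw [lintegral_union (hKm.compl.prod hKm) hdisj]
      _ ≤ _ := setLIntegral_le_lintegral _ _
  have hI0 : 0 ≤ ∫ x, φ x ∂γ := integral_nonneg hφ0
  have hI2 : ∫ x, ‖x - p x‖ ^ 2 ∂γ = 2 * ∫ x, φ x ∂γ := by
    rw [← integral_const_mul]; congr 1; ext x; simp only [hφ]; ring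
  have hQ := hlow.trans hP
  rw [← ENNReal.ofReal_mul (by positivity), ENNReal.ofReal_le_ofReal_iff
    (mul_nonneg (by positivity) (integral_nonneg fun _ => sq_nonneg _)), hI2] at hQ
  -- with `γ K ≥ 1 / 2` and `π ^ 2 ≤ 10` the second moment of `φ` is at most `5` times its mean
  have hpi : Real.pi ^ 2 ≤ 10 := by nlinarith [Real.pi_lt_d2, Real.pi_pos]
  have hS0 : 0 ≤ ∫ x, φ x ^ 2 ∂γ := integral_nonneg fun _ => sq_nonneg _
  have hS : ∫ x, φ x ^ 2 ∂γ ≤ 5 * ∫ x, φ x ∂γ := by nlinarith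
  -- Cauchy–Schwarz, as nonnegativity of a square with the optimal parameter
  have hCS : (∫ x, φ x ∂γ) ^ 2 ≤ γ.real Kᶜ * ∫ x, φ x ^ 2 ∂γ := by
    have hsupp : ∀ t : ℝ, 0 ≤ γ.real Kᶜ * (t * t) + (-2 * ∫ x, φ x ∂γ) * t
        + ∫ x, φ x ^ 2 ∂γ := by
      intro t
      have hi : Integrable (Kᶜ.indicator fun _ => t * t) γ :=
        (integrable_const _).indicator hKm.compl
      have : 0 ≤ ∫ x, (φ x - Kᶜ.indicator (fun _ => t) x) ^ 2 ∂γ :=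
        integral_nonneg fun _ => sq_nonneg _
      have e : ∀ x, (φ x - Kᶜ.indicator (fun _ => t) x) ^ 2
          = φ x ^ 2 - (2 * t) * φ x + Kᶜ.indicator (fun _ => t * t) x := by
        intro x
        by_cases hx : x ∈ K
        · simp [hx, hφK x hx]
        · simp [hx]; ring
      simp_rw [e] at this
      rw [integral_add (f := fun x => φ x ^ 2 - 2 * t * φ x) (h4.sub (h1.const_mul _)) hi,
        integral_sub h4 (h1.const_mul _),
        integral_const_mul, integral_indicator_const _ hKm.compl] at this
      simp only [smul_eq_mul] at this
      linarith
    have := discrim_le_zero hsupp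
    unfold discrim at this
    nlinarith
  rw [hI2]
  have hfin : ∫ x, φ x ∂γ ≤ 5 * γ.real Kᶜ := by
    by_contra! hc
    have hc0 : 0 ≤ γ.real Kᶜ := measureReal_nonneg
    nlinarith [mul_le_mul_of_nonneg_left hS hc0]
  linarith

end Concentration

/-! ### The noise excess of a convex combination -/

section NoiseBound

variable {E : Type*} [NormedAddCommGroup E] [InnerProductSpace ℝ E] [FiniteDimensional ℝ E]
  [MeasurableSpace E] [BorelSpace E]

lemma map_inner_stdGaussian (v : E) :
    (stdGaussian E).map (innerSL ℝ v) = gaussianReal 0 (‖v‖ ^ 2).toNNReal := by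
  rw [IsGaussian.map_eq_gaussianReal, integral_strongDual_stdGaussian, variance_dual_stdGaussian,
    innerSL_apply_norm]

lemma stdGaussian_real_lt_inner_le (v : E) {u l : ℝ} (hu : 0 ≤ u) (hl : √(2 * u) * ‖v‖ ≤ l) :
    (stdGaussian E).real {x | l < inner ℝ v x} ≤ Real.exp (-u) := by
  have hl0 : 0 ≤ l := (by positivity : 0 ≤ √(2 * u) * ‖v‖).trans hl
  by_cases hv : v = 0
  · have : {x : E | l < inner ℝ v x} = ∅ := by
      ext x; simp [hv, hl0]
    rw [this]; simp [Real.exp_nonneg]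
  have hv0 : 0 < ‖v‖ := norm_pos_iff.2 hv
  have hexp : Integrable (fun x => Real.exp (l / ‖v‖ ^ 2 * innerSL ℝ v x)) (stdGaussian E) := by
    have := integrable_exp_mul_gaussianReal (μ := 0) (v := (‖v‖ ^ 2).toNNReal) (l / ‖v‖ ^ 2)
    rw [← map_inner_stdGaussian, integrable_map_measure (by fun_prop) (by fun_prop)] at this
    exact this
  have h := measure_ge_le_exp_mul_mgf (μ := stdGaussian E) (X := innerSL ℝ v) (t := l / ‖v‖ ^ 2)
    l (by positivity) hexp
  rw [mgf_gaussianReal (map_inner_stdGaussian v), ← Real.exp_add] at h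
  have hsub : {x : E | l < inner ℝ v x} ⊆ {x | l ≤ innerSL ℝ v x} := fun x hx => by
    simp only [Set.mem_ofPred_eq, innerSL_apply_apply] at hx ⊢; exact hx.le
  refine (measureReal_mono hsub).trans (h.trans (Real.exp_le_exp.2 ?_))
  rw [Real.coe_toNNReal _ (sq_nonneg _)]
  have hsq : 2 * u * ‖v‖ ^ 2 ≤ l ^ 2 := by
    calc 2 * u * ‖v‖ ^ 2 = (√(2 * u) * ‖v‖) ^ 2 := by
          rw [mul_pow, Real.sq_sqrt (by positivity)]
      _ ≤ l ^ 2 := by gcongr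
  have e : -(l / ‖v‖ ^ 2) * l + (0 * (l / ‖v‖ ^ 2) + ‖v‖ ^ 2 * (l / ‖v‖ ^ 2) ^ 2 / 2)
      = -(l ^ 2 / (2 * ‖v‖ ^ 2)) := by
    field_simp; ring
  rw [e, neg_le_neg_iff, le_div_iff₀ (by positivity)]
  linarith

lemma integral_norm_sq_starProjection (W : Submodule ℝ E) :
    Integrable (fun x => ‖W.starProjection x‖ ^ 2) (stdGaussian E) ∧
    ∫ x, ‖W.starProjection x‖ ^ 2 ∂(stdGaussian E) = Module.finrank ℝ W := by
  set b := stdOrthonormalBasis ℝ W with hb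
  have e : ∀ x : E, ‖W.starProjection x‖ ^ 2 = ∑ i, inner ℝ (b i : E) x ^ 2 := by
    intro x
    have h := b.sum_sq_inner_right (W.orthogonalProjectionOnto x)
    rw [Submodule.starProjection_apply, Submodule.norm_coe, ← h]
    refine Finset.sum_congr rfl fun i _ => ?_
    rw [Submodule.coe_inner, ← Submodule.starProjection_apply,
      ← Submodule.inner_starProjection_left_eq_right,
      Submodule.starProjection_eq_self_iff.2 (b i).2]
  have hi : ∀ v : E, Integrable (fun x => inner ℝ v x ^ 2) (stdGaussian E) := fun v =>
    (IsGaussian.memLp_dual (stdGaussian E) (innerSL ℝ v) 2 (by simp)).integrable_sq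
  simp_rw [e]
  refine ⟨integrable_finsetSum _ fun i _ => hi _, ?_⟩
  rw [integral_finsetSum _ fun i _ => hi _]
  have h1 : ∀ i, ∫ x, inner ℝ (b i : E) x ^ 2 ∂(stdGaussian E) = 1 := by
    intro i
    have := lintegral_inner_sq_stdGaussian (b i : E)
    rw [← ofReal_integral_eq_lintegral_ofReal (hi _)
      (Filter.Eventually.of_forall fun _ => sq_nonneg _)] at this
    have hn : ‖(b i : E)‖ = 1 := b.orthonormal.1 i
    rw [hn] at this
    have := (ENNReal.ofReal_eq_ofReal_iff (integral_nonneg fun _ => sq_nonneg _)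
      (by norm_num)).1 this
    simpa using this
  simp [h1]

variable {ι : Type*} [Fintype ι]

/-- Gaussian noise tested against the convex combinations of vectors `U k`. Outside the exceptional
set `F` the level `l k` dominates the noise in direction `U k` with probability `1 - exp (-u)`. The
noise then exceeds the averaged level by at most a small multiple of `‖∑ k, w k • U k‖`,
simultaneously for all weights `w`. The exceptional directions are projected out; what remains lies,
up to its distance to a convex polytope of large Gaussian measure, below the levels. -/
lemma exists_noise_bound (U : ι → E) (l : ι → ℝ) (F : Finset ι) {u : ℝ} (hu : 0 ≤ u)
    (hl : ∀ k, 0 ≤ l k) (hF : ∀ k ∉ F, √(2 * u) * ‖U k‖ ≤ l k)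
    (hB : Fintype.card ι * Real.exp (-u) ≤ 1 / 2) :
    ∃ ψ : E → ℝ, (∀ x, 0 ≤ ψ x) ∧ Integrable ψ (stdGaussian E) ∧
      ∫ x, ψ x ∂(stdGaussian E) ≤ 20 * (Fintype.card ι * Real.exp (-u)) + 2 * F.card ∧
      ∀ (x : E) (w : ι → ℝ), (∀ k, 0 ≤ w k) →
        inner ℝ x (∑ k, w k • U k) ≤ √(ψ x) * ‖∑ k, w k • U k‖ + ∑ k, w k * l k := by
  classical
  set γ := stdGaussian E with hγ
  set W : Submodule ℝ E := Submodule.span ℝ (F.image U : Set E) with hW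
  set K : Set E := {x | ∀ k, inner ℝ (Wᗮ.starProjection (U k)) x ≤ l k} with hK
  have hKi : K = ⋂ k, {x | inner ℝ (Wᗮ.starProjection (U k)) x ≤ l k} := by
    ext x; simp [hK]
  have hcl : IsClosed K := by
    rw [hKi]
    exact isClosed_iInter fun k => isClosed_le (by fun_prop) continuous_const
  have hcv : Convex ℝ K := by
    rw [hKi]
    exact convex_iInter fun k =>
      convex_halfSpace_le (innerSL ℝ (Wᗮ.starProjection (U k))).isLinear _
  obtain ⟨p, hp⟩ := exists_isConvexProj ⟨(0 : E), by simpa [hK] using hl⟩ hcl hcv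
  have hcompl : γ.real Kᶜ ≤ Fintype.card ι * Real.exp (-u) := by
    have e : Kᶜ = ⋃ k ∈ (Finset.univ : Finset ι),
        {x | l k < inner ℝ (Wᗮ.starProjection (U k)) x} := by
      ext x; simp [hK]
    rw [e]
    refine (measureReal_biUnion_finset_le _ _).trans ?_
    refine (Finset.sum_le_card_nsmul _ _ (Real.exp (-u)) fun k _ => ?_).trans (by simp)
    refine stdGaussian_real_lt_inner_le _ hu ?_
    by_cases hk : k ∈ F
    · have : U k ∈ W := Submodule.subset_span (by
        simp only [Finset.coe_image]; exact ⟨k, hk, rfl⟩)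
      rw [Submodule.starProjection_orthogonal_apply_eq_zero this]
      simpa using hl k
    · refine le_trans ?_ (hF k hk)
      gcongr
      exact Submodule.norm_starProjection_apply_le _ _
  have hKmass : 1 / 2 ≤ γ.real K := by
    have := probReal_add_probReal_compl (μ := γ) hcl.measurableSet
    linarith
  obtain ⟨hi1, hd⟩ := integral_sq_dist_convex_le hcl hp hKmass
  obtain ⟨hi2, hw⟩ := integral_norm_sq_starProjection W
  have hrank : (Module.finrank ℝ W : ℝ) ≤ F.card := by
    exact_mod_cast (finrank_span_finset_le_card (F.image U)).trans Finset.card_image_le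
  -- `√(ψ x)` dominates the norm of the part of `x` in `W` plus the distance of `x` to `K`
  refine ⟨fun x => 2 * ‖W.starProjection x‖ ^ 2 + 2 * ‖x - p x‖ ^ 2, fun x => by positivity,
    (hi2.const_mul 2).add (hi1.const_mul 2), ?_, ?_⟩
  · rw [integral_add (hi2.const_mul 2) (hi1.const_mul 2), integral_const_mul, integral_const_mul,
      hw]
    linarith
  · intro x w hw0
    set Z := ∑ k, w k • U k with hZ
    have hsplit : x = W.starProjection x + Wᗮ.starProjection (x - p x)
        + Wᗮ.starProjection (p x) := by
      rw [map_sub, add_assoc, sub_add_cancel, W.starProjection_orthogonal_val]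
      abel
    have h3 : inner ℝ (Wᗮ.starProjection (p x)) Z ≤ ∑ k, w k * l k := by
      rw [hZ, inner_sum]
      refine Finset.sum_le_sum fun k _ => ?_
      rw [inner_smul_right]
      refine mul_le_mul_of_nonneg_left ?_ (hw0 k)
      rw [Submodule.inner_starProjection_left_eq_right, real_inner_comm]
      exact hp.mem x k
    have h1 := real_inner_le_norm (W.starProjection x) Z
    have h2 := real_inner_le_norm (Wᗮ.starProjection (x - p x)) Z
    have h2' : ‖Wᗮ.starProjection (x - p x)‖ ≤ ‖x - p x‖ :=
      Submodule.norm_starProjection_apply_le _ _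
    have hsq : ‖W.starProjection x‖ + ‖x - p x‖
        ≤ √(2 * ‖W.starProjection x‖ ^ 2 + 2 * ‖x - p x‖ ^ 2) := by
      refine Real.le_sqrt_of_sq_le ?_
      nlinarith [sq_nonneg (‖W.starProjection x‖ - ‖x - p x‖)]
    have hxZ : inner ℝ x Z = inner ℝ (W.starProjection x) Z
        + inner ℝ (Wᗮ.starProjection (x - p x)) Z + inner ℝ (Wᗮ.starProjection (p x)) Z := by
      rw [← inner_add_left, ← inner_add_left, ← hsplit]
    rw [hxZ]
    have h4 := mul_le_mul_of_nonneg_right h2' (norm_nonneg Z)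
    have h5 := mul_le_mul_of_nonneg_right hsq (norm_nonneg Z)
    nlinarith

end NoiseBound

section NoiseExcess

variable {E : Type*} [NormedAddCommGroup E] [InnerProductSpace ℝ E]
  {ι : Type*} [Fintype ι] {n : ℕ}

/-- The empirical variance in direction `v` of a centred sample `Y`. -/
noncomputable def sampleVar (Y : Fin n → E) (v : E) : ℝ :=
  1 / ((n : ℝ) - 1) * ∑ i, inner ℝ v (Y i) ^ 2

/-- The largest amount, over the weights `w` in the simplex, by which the noise `2 ⟨e, Z⟩` at
`Z = ∑ k, w k • V k` exceeds the empirical penalty `16 √u ∑ k, w k √(sampleVar Y (V k) / n)` plus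
the fraction `η` of `‖Z‖²`. -/
noncomputable def noiseExcess (u η : ℝ) (e : E) (Y : Fin n → E) (V : ι → E) : ℝ :=
  sSup ((fun w : ι → ℝ => 2 * inner ℝ e (∑ k, w k • V k)
    - 16 * √u * ∑ k, w k * √(sampleVar Y (V k) / n) - η * ‖∑ k, w k • V k‖ ^ 2) ''
      stdSimplex ℝ ι)

lemma sampleVar_nonneg (hn : 1 ≤ n) (Y : Fin n → E) (v : E) : 0 ≤ sampleVar Y v := by
  have : (1 : ℝ) ≤ n := by exact_mod_cast hn
  exact mul_nonneg (div_nonneg zero_le_one (by linarith)) (Finset.sum_nonneg fun _ _ => sq_nonneg _)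

lemma continuous_noiseExcess (u η : ℝ) :
    Continuous fun p : (E × (Fin n → E)) × (ι → E) => noiseExcess u η p.1.1 p.1.2 p.2 := by
  unfold noiseExcess
  refine IsCompact.continuous_sSup (isCompact_stdSimplex ℝ ι) ?_
  simp only [Function.HasUncurry.uncurry, sampleVar, id]
  fun_prop

lemma le_noiseExcess (u η : ℝ) (e : E) (Y : Fin n → E) (V : ι → E) {w : ι → ℝ}
    (hw : w ∈ stdSimplex ℝ ι) :
    2 * inner ℝ e (∑ k, w k • V k) - 16 * √u * ∑ k, w k * √(sampleVar Y (V k) / n)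
      - η * ‖∑ k, w k • V k‖ ^ 2 ≤ noiseExcess u η e Y V := by
  refine le_csSup ?_ (Set.mem_image_of_mem _ hw)
  refine ((isCompact_stdSimplex ℝ ι).image ?_).bddAbove
  fun_prop

lemma noiseExcess_nonneg (u η : ℝ) (e : E) (Y : Fin n → E) (V : ι → E) {k : ι} (hk : V k = 0) :
    0 ≤ noiseExcess u η e Y V := by
  classical
  have h := le_noiseExcess u η e Y V (single_mem_stdSimplex ℝ k)
  simpa [Pi.single_apply, ite_smul, hk, sampleVar] using h

lemma noiseExcess_le [Nonempty ι] {u η : ℝ} {e : E} {Y : Fin n → E} {V : ι → E} {c : ℝ}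
    (h : ∀ w ∈ stdSimplex ℝ ι, 2 * inner ℝ e (∑ k, w k • V k)
      - 16 * √u * ∑ k, w k * √(sampleVar Y (V k) / n) - η * ‖∑ k, w k • V k‖ ^ 2 ≤ c) :
    noiseExcess u η e Y V ≤ c := by
  classical
  refine csSup_le ?_ ?_
  · exact Set.Nonempty.image _ ⟨_, single_mem_stdSimplex ℝ (Classical.arbitrary ι)⟩
  · rintro _ ⟨w, hw, rfl⟩; exact h w hw

variable [FiniteDimensional ℝ E] [MeasurableSpace E] [BorelSpace E]

open Classical in
/-- The noise excess, averaged over the Gaussian noise only: it is controlled by the number of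
directions `V k` whose variance is badly underestimated by the sample `Y`. -/
lemma lintegral_noiseExcess_le [Nonempty ι] (hn : 1 ≤ n) (A : E →L[ℝ] E) {ρ : ℝ} (hρ : 0 ≤ ρ)
    (hA : ∀ z, ‖A.adjoint z‖ ^ 2 ≤ ρ * ‖z‖ ^ 2) {u η : ℝ} (hu : 0 ≤ u) (hη : 0 < η)
    (hB : Fintype.card ι * Real.exp (-u) ≤ 1 / 2) (Y : Fin n → E) (V : ι → E) :
    ∫⁻ x, ENNReal.ofReal (noiseExcess u η ((√(n : ℝ))⁻¹ • A x) Y V) ∂(stdGaussian E)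
      ≤ ENNReal.ofReal (ρ / (n * η) * (20 * (Fintype.card ι * Real.exp (-u)) +
        2 * ∑ k, if sampleVar Y (V k) < ‖A.adjoint (V k)‖ ^ 2 / 32 then (1 : ℝ) else 0)) := by
  have hn0 : (0 : ℝ) < n := by exact_mod_cast hn
  set F : Finset ι := {k | sampleVar Y (V k) < ‖A.adjoint (V k)‖ ^ 2 / 32} with hFdef
  obtain ⟨ψ, hψ0, hψi, hψ, hmain⟩ := exists_noise_bound (fun k => A.adjoint (V k))
    (fun k => 8 * √u * √(sampleVar Y (V k))) F hu (fun k => by positivity) (by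
      intro k hk
      simp only [hFdef, Finset.mem_filter, Finset.mem_univ, true_and, not_lt] at hk
      -- outside `F` the level `8 √u √sampleVar` covers `√(2 u)` standard deviations: `8² = 2 · 32`
      have h1 : ‖A.adjoint (V k)‖ ≤ √(32 * sampleVar Y (V k)) :=
        Real.le_sqrt_of_sq_le (by linarith)
      refine (mul_le_mul_of_nonneg_left h1 (Real.sqrt_nonneg _)).trans (le_of_eq ?_)
      have h8 : (8 : ℝ) = √64 := by
        rw [show (64 : ℝ) = 8 ^ 2 by norm_num]; simp
      rw [h8, ← Real.sqrt_mul (by positivity), ← Real.sqrt_mul (by norm_num),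
        ← Real.sqrt_mul (by positivity)]
      congr 1; ring) hB
  have hcard : (F.card : ℝ) = ∑ k, if sampleVar Y (V k) < ‖A.adjoint (V k)‖ ^ 2 / 32
      then (1 : ℝ) else 0 := by
    rw [hFdef, Finset.sum_boole]
  have hpt : ∀ x, noiseExcess u η ((√(n : ℝ))⁻¹ • A x) Y V ≤ ρ / (n * η) * ψ x := by
    intro x
    refine noiseExcess_le fun w hw => ?_
    have h := hmain x w hw.1
    set Z := ∑ k, w k • V k with hZ
    have hAZ : ∑ k, w k • A.adjoint (V k) = A.adjoint Z := by simp [hZ, map_sum]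
    rw [hAZ, ContinuousLinearMap.adjoint_inner_right] at h
    have hnorm : ‖A.adjoint Z‖ ≤ √ρ * ‖Z‖ := by
      rw [← Real.sqrt_sq (norm_nonneg Z), ← Real.sqrt_mul hρ]
      exact Real.le_sqrt_of_sq_le (hA Z)
    have hpen : 16 * √u * ∑ k, w k * √(sampleVar Y (V k) / n)
        = 2 * (√(n : ℝ))⁻¹ * ∑ k, w k * (8 * √u * √(sampleVar Y (V k))) := by
      rw [Finset.mul_sum, Finset.mul_sum]
      refine Finset.sum_congr rfl fun k _ => ?_
      rw [Real.sqrt_div' _ hn0.le]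
      field_simp; ring
    rw [hpen, inner_smul_left, RCLike.conj_to_real]
    have hs : 0 < (√(n : ℝ))⁻¹ := by positivity
    have hss : (√(n : ℝ))⁻¹ ^ 2 = 1 / n := by
      rw [inv_pow, Real.sq_sqrt hn0.le, one_div]
    have h1 : √(ψ x) * ‖A.adjoint Z‖ ≤ √(ψ x) * (√ρ * ‖Z‖) := by gcongr
    -- Young's inequality with weight `η`
    have h2 : 2 * (√(n : ℝ))⁻¹ * (√(ψ x) * (√ρ * ‖Z‖))
        ≤ η * ‖Z‖ ^ 2 + ρ / (n * η) * ψ x := by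
      have e : ρ / (n * η) * ψ x = ((√(n : ℝ))⁻¹ * √(ψ x) * √ρ) ^ 2 / η := by
        rw [mul_pow, mul_pow, hss, Real.sq_sqrt hρ, Real.sq_sqrt (hψ0 x)]
        field_simp
      have hsq := sq_nonneg (√η * ‖Z‖ - (√(n : ℝ))⁻¹ * √(ψ x) * √ρ / √η)
      have hη2 := Real.sq_sqrt hη.le
      have hηs : 0 < √η := Real.sqrt_pos.2 hη
      have e2 : (√η * ‖Z‖ - (√(n : ℝ))⁻¹ * √(ψ x) * √ρ / √η) ^ 2
          = η * ‖Z‖ ^ 2 - 2 * (√(n : ℝ))⁻¹ * (√(ψ x) * (√ρ * ‖Z‖))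
            + ((√(n : ℝ))⁻¹ * √(ψ x) * √ρ) ^ 2 / η := by
        rw [← hη2, Real.sqrt_sq hηs.le]; field_simp; ring
      rw [e]; linarith
    have h3 := mul_le_mul_of_nonneg_left (h.trans (add_le_add_left h1 _))
      (by positivity : 0 ≤ 2 * (√(n : ℝ))⁻¹)
    linarith
  calc ∫⁻ x, ENNReal.ofReal (noiseExcess u η ((√(n : ℝ))⁻¹ • A x) Y V) ∂(stdGaussian E)
      ≤ ∫⁻ x, ENNReal.ofReal (ρ / (n * η) * ψ x) ∂(stdGaussian E) :=
        lintegral_mono fun x => ENNReal.ofReal_le_ofReal (hpt x)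
    _ = ENNReal.ofReal (∫ x, ρ / (n * η) * ψ x ∂(stdGaussian E)) := by
        rw [ofReal_integral_eq_lintegral_ofReal (hψi.const_mul _)
          (Filter.Eventually.of_forall fun x => mul_nonneg (by positivity) (hψ0 x))]
    _ ≤ _ := by
        refine ENNReal.ofReal_le_ofReal ?_
        rw [integral_const_mul, ← hcard]
        gcongr

open Classical in
/-- The mean noise excess when the noise, the centred sample and the directions are independent and
the sample underestimates the variance of any fixed direction with probability at most
`exp (-u)`. -/
lemma lintegral_noiseExcess_prod_le [Nonempty ι] (hn : 1 ≤ n) (A : E →L[ℝ] E) {ρ : ℝ} (hρ : 0 ≤ ρ)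
    (hA : ∀ z, ‖A.adjoint z‖ ^ 2 ≤ ρ * ‖z‖ ^ 2) {u η : ℝ} (hu : 0 ≤ u) (hη : 0 < η)
    (hB : Fintype.card ι * Real.exp (-u) ≤ 1 / 2)
    (νY : Measure (Fin n → E)) [IsProbabilityMeasure νY]
    (νV : Measure (ι → E)) [IsProbabilityMeasure νV]
    (hY : ∀ v, νY.real {Y | sampleVar Y v < ‖A.adjoint v‖ ^ 2 / 32} ≤ Real.exp (-u)) :
    ∫⁻ z, ENNReal.ofReal (noiseExcess u η z.1.1 z.1.2 z.2)
      ∂((((stdGaussian E).map (fun x => (√(n : ℝ))⁻¹ • A x)).prod νY).prod νV)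
      ≤ ENNReal.ofReal (ρ / (n * η) * (22 * (Fintype.card ι * Real.exp (-u)))) := by
  have hn0 : (0 : ℝ) < n := by exact_mod_cast hn
  have hm : Measurable fun z : (E × (Fin n → E)) × (ι → E) =>
      ENNReal.ofReal (noiseExcess u η z.1.1 z.1.2 z.2) :=
    (continuous_noiseExcess u η).measurable.ennreal_ofReal
  have hAm : Measurable fun x : E => (√(n : ℝ))⁻¹ • A x := by fun_prop
  have : IsProbabilityMeasure ((stdGaussian E).map (fun x => (√(n : ℝ))⁻¹ • A x)) :=
    Measure.isProbabilityMeasure_map hAm.aemeasurable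
  rw [lintegral_prod_symm _ hm.aemeasurable]
  have hset : ∀ v : E, MeasurableSet {Y : Fin n → E | sampleVar Y v < ‖A.adjoint v‖ ^ 2 / 32} := by
    intro v
    refine (isOpen_lt ?_ continuous_const).measurableSet
    unfold sampleVar; fun_prop
  have hV : ∀ V : ι → E, ∫⁻ p, ENNReal.ofReal (noiseExcess u η p.1 p.2 V)
      ∂(((stdGaussian E).map (fun x => (√(n : ℝ))⁻¹ • A x)).prod νY)
      ≤ ENNReal.ofReal (ρ / (n * η) * (22 * (Fintype.card ι * Real.exp (-u)))) := by
    intro V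
    have hm2 : Measurable fun p : E × (Fin n → E) =>
        ENNReal.ofReal (noiseExcess u η p.1 p.2 V) := by
      have hc : Continuous fun p : E × (Fin n → E) => (p, V) := by fun_prop
      exact ((continuous_noiseExcess u η).comp hc).measurable.ennreal_ofReal
    have hind : ∀ k, (fun Y : Fin n → E => if sampleVar Y (V k) < ‖A.adjoint (V k)‖ ^ 2 / 32
        then (1 : ℝ) else 0) = Set.indicator
          {Y | sampleVar Y (V k) < ‖A.adjoint (V k)‖ ^ 2 / 32} (fun _ => 1) := by
      intro k; ext Y; simp [Set.indicator_apply]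
    have hint : ∀ k, Integrable (fun Y : Fin n → E =>
        if sampleVar Y (V k) < ‖A.adjoint (V k)‖ ^ 2 / 32 then (1 : ℝ) else 0) νY := fun k => by
      rw [hind]; exact (integrable_const _).indicator (hset _)
    set N : (Fin n → E) → ℝ := fun Y => ∑ k,
      if sampleVar Y (V k) < ‖A.adjoint (V k)‖ ^ 2 / 32 then (1 : ℝ) else 0 with hN
    have hN0 : ∀ Y, 0 ≤ N Y := fun Y => Finset.sum_nonneg fun k _ => by split_ifs <;> norm_num
    have hNi : Integrable N νY := integrable_finsetSum _ fun k _ => hint k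
    have hNle : ∫ Y, N Y ∂νY ≤ Fintype.card ι * Real.exp (-u) := by
      rw [hN, integral_finsetSum _ fun k _ => hint k]
      refine (Finset.sum_le_card_nsmul _ _ (Real.exp (-u)) fun k _ => ?_).trans (by simp)
      rw [hind, integral_indicator_const _ (hset _)]
      simpa using hY (V k)
    have hle : ∀ Y, ∫⁻ x, ENNReal.ofReal (noiseExcess u η x Y V)
        ∂((stdGaussian E).map (fun x => (√(n : ℝ))⁻¹ • A x)) ≤
        ENNReal.ofReal (ρ / (n * η) * (20 * (Fintype.card ι * Real.exp (-u)) + 2 * N Y)) := by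
      intro Y
      have hm3 : Measurable fun x : E => ENNReal.ofReal (noiseExcess u η x Y V) := by
        have hc : Continuous fun x : E => ((x, Y), V) := by fun_prop
        exact ((continuous_noiseExcess u η).comp hc).measurable.ennreal_ofReal
      rw [lintegral_map hm3 hAm]
      exact lintegral_noiseExcess_le hn A hρ hA hu hη hB Y V
    have hc : 0 ≤ ρ / (n * η) := by positivity
    have hd : 0 ≤ Fintype.card ι * Real.exp (-u) := by positivity
    generalize Fintype.card ι * Real.exp (-u) = D at hd hNle hle ⊢
    generalize ρ / (n * η) = c at hc hle ⊢
    have hsum : Integrable (fun Y : Fin n → E => c * (20 * D + 2 * N Y)) νY :=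
      ((integrable_const _).add (hNi.const_mul _)).const_mul _
    rw [lintegral_prod_symm _ hm2.aemeasurable]
    calc ∫⁻ Y, ∫⁻ x, ENNReal.ofReal (noiseExcess u η x Y V)
          ∂((stdGaussian E).map (fun x => (√(n : ℝ))⁻¹ • A x)) ∂νY
        ≤ ∫⁻ Y, ENNReal.ofReal (c * (20 * D + 2 * N Y)) ∂νY := lintegral_mono hle
      _ ≤ _ := by
          rw [← ofReal_integral_eq_lintegral_ofReal hsum (Filter.Eventually.of_forall fun Y =>
            mul_nonneg hc (by linarith [hN0 Y]))]
          refine ENNReal.ofReal_le_ofReal ?_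
          rw [integral_const_mul, integral_add (integrable_const _) (hNi.const_mul _),
            integral_const, integral_const_mul, probReal_univ, one_smul]
          exact mul_le_mul_of_nonneg_left (by linarith) hc
  calc _ ≤ ∫⁻ _V, ENNReal.ofReal (ρ / (n * η) * (22 * (Fintype.card ι * Real.exp (-u)))) ∂νV :=
        lintegral_mono hV
    _ = _ := by simp

end NoiseExcess

/-! ### Quadratic forms of covariance matrices -/

section Quad

open scoped MatrixOrder

variable {d : ℕ}

/-- The quadratic form `v ↦ vᵀ S v`. -/
noncomputable def quad (S : Matrix (Fin d) (Fin d) ℝ) (v : EuclideanSpace ℝ (Fin d)) : ℝ :=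
  v.ofLp ⬝ᵥ (S *ᵥ v.ofLp)

/-- The linear map of the square root of a covariance matrix `S`, which sends a standard Gaussian
vector to one with covariance `S`. -/
noncomputable def sqrtMap (S : Matrix (Fin d) (Fin d) ℝ) :
    EuclideanSpace ℝ (Fin d) →L[ℝ] EuclideanSpace ℝ (Fin d) :=
  Matrix.toEuclideanCLM (𝕜 := ℝ) (CFC.sqrt S)

variable {S : Matrix (Fin d) (Fin d) ℝ}

lemma adjoint_sqrtMap (S : Matrix (Fin d) (Fin d) ℝ) :
    (sqrtMap S).adjoint = sqrtMap S :=
  IsSelfAdjoint.adjoint_eq ((CFC.sqrt_nonneg S).isSelfAdjoint.map _)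

lemma norm_adjoint_sqrtMap_sq (hS : S.PosSemidef) (v : EuclideanSpace ℝ (Fin d)) :
    ‖(sqrtMap S).adjoint v‖ ^ 2 = quad S v := by
  rw [← real_inner_self_eq_norm_sq, ContinuousLinearMap.adjoint_inner_left, adjoint_sqrtMap,
    sqrtMap, ← ContinuousLinearMap.comp_apply, ← ContinuousLinearMap.mul_def, ← map_mul,
    CFC.sqrt_mul_sqrt_self _ hS.nonneg, Matrix.inner_toEuclideanCLM, quad]

lemma quad_nonneg (hS : S.PosSemidef) (v : EuclideanSpace ℝ (Fin d)) : 0 ≤ quad S v := by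
  rw [← norm_adjoint_sqrtMap_sq hS]; positivity

lemma quad_smul (c : ℝ) (v : EuclideanSpace ℝ (Fin d)) : quad S (c • v) = c ^ 2 * quad S v := by
  simp [quad, Matrix.mulVec_smul, smul_dotProduct, dotProduct_smul]; ring

lemma trace_mul_self_eq (hS : S.PosSemidef) : (S * S).trace = ∑ i, ∑ j, S i j ^ 2 := by
  simp only [Matrix.trace, Matrix.diag_apply, Matrix.mul_apply]
  refine Finset.sum_congr rfl fun i _ => Finset.sum_congr rfl fun j _ => ?_
  have : S j i = S i j := by simpa using hS.isHermitian.apply i j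
  rw [this, sq]

lemma trace_mul_self_nonneg (hS : S.PosSemidef) : 0 ≤ (S * S).trace := by
  rw [trace_mul_self_eq hS]; positivity

/-- The operator norm of a covariance matrix is at most its Frobenius norm. -/
lemma quad_le (hS : S.PosSemidef) (v : EuclideanSpace ℝ (Fin d)) :
    quad S v ≤ √((S * S).trace) * ‖v‖ ^ 2 := by
  have h1 : quad S v = inner ℝ v (Matrix.toEuclideanCLM (𝕜 := ℝ) S v) := by
    rw [Matrix.inner_toEuclideanCLM, quad]
  have h2 : ‖Matrix.toEuclideanCLM (𝕜 := ℝ) S v‖ ≤ √((S * S).trace) * ‖v‖ := by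
    rw [← Real.sqrt_sq (norm_nonneg v), ← Real.sqrt_mul (trace_mul_self_nonneg hS)]
    refine Real.le_sqrt_of_sq_le ?_
    rw [EuclideanSpace.real_norm_sq_eq, EuclideanSpace.real_norm_sq_eq, trace_mul_self_eq hS,
      Finset.sum_mul]
    refine Finset.sum_le_sum fun i _ => ?_
    rw [Matrix.ofLp_toEuclideanCLM]
    exact Finset.sum_mul_sq_le_sq_mul_sq (R := ℝ) Finset.univ (S i) v.ofLp
  rw [h1]
  refine (real_inner_le_norm _ _).trans ?_
  nlinarith [mul_le_mul_of_nonneg_left h2 (norm_nonneg v)]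

variable {Ω : Type*} [MeasurableSpace Ω] {P : Measure Ω}

/-- The mean of a quadratic form of a random vector with mean `Δ` and covariance `R`. -/
lemma integral_quad (hS : S.PosSemidef) {W : Ω → EuclideanSpace ℝ (Fin d)}
    {Δ : EuclideanSpace ℝ (Fin d)} {R : Matrix (Fin d) (Fin d) ℝ}
    (hi : ∀ v, Integrable (fun a => inner ℝ v (W a) ^ 2) P)
    (hW : ∀ v, ∫ a, inner ℝ v (W a) ^ 2 ∂P = inner ℝ v Δ ^ 2 + quad R v) :
    Integrable (fun a => quad S (W a)) P ∧ ∫ a, quad S (W a) ∂P = quad S Δ + (S * R).trace := by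
  set b : Fin d → EuclideanSpace ℝ (Fin d) := fun i => sqrtMap S (EuclideanSpace.basisFun _ ℝ i)
    with hb
  have e : ∀ x, quad S x = ∑ i, inner ℝ (b i) x ^ 2 := by
    intro x
    rw [← norm_adjoint_sqrtMap_sq hS,
      ← (EuclideanSpace.basisFun (Fin d) ℝ).sum_sq_inner_right]
    simp only [hb, ContinuousLinearMap.adjoint_inner_right]
  have htr : ∑ i, quad R (b i) = (S * R).trace := by
    have h1 : ∀ i, (b i).ofLp = fun j => CFC.sqrt S j i := by
      intro i
      simp only [hb, sqrtMap, Matrix.ofLp_toEuclideanCLM]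
      ext j; simp [Matrix.mulVec]
    have h2 : ∑ i, quad R (b i) = ((CFC.sqrt S)ᵀ * R * CFC.sqrt S).trace := by
      simp only [quad, h1, Matrix.trace, Matrix.diag_apply, Matrix.mul_apply, dotProduct,
        Matrix.mulVec, Matrix.transpose_apply, Finset.sum_mul, Finset.mul_sum]
      refine Finset.sum_congr rfl fun i _ => ?_
      rw [Finset.sum_comm]
      exact Finset.sum_congr rfl fun _ _ => Finset.sum_congr rfl fun _ _ => by ring
    have h3 : (CFC.sqrt S)ᵀ = CFC.sqrt S := by
      have : (CFC.sqrt S).IsHermitian := (CFC.sqrt_nonneg S).isSelfAdjoint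
      simpa [Matrix.IsHermitian] using this
    rw [h2, h3, Matrix.trace_mul_cycle, CFC.sqrt_mul_sqrt_self _ hS.nonneg]
  simp_rw [e]
  refine ⟨integrable_finsetSum _ fun i _ => hi _, ?_⟩
  rw [integral_finsetSum _ fun i _ => hi _]
  simp_rw [hW]
  rw [Finset.sum_add_distrib, htr]

end Quad

/-! ### Integration of functions of independent random vectors -/

section Indep

variable {Ω α β : Type*} [MeasurableSpace Ω] [MeasurableSpace α] [MeasurableSpace β]
  {P : Measure Ω} [IsProbabilityMeasure P] {U : Ω → α} {V : Ω → β}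

lemma lintegral_indep (hU : AEMeasurable U P) (hV : AEMeasurable V P) (h : IndepFun U V P)
    {f : α × β → ENNReal} (hf : Measurable f) :
    ∫⁻ a, f (U a, V a) ∂P = ∫⁻ a, ∫⁻ b, f (U a, V b) ∂P ∂P := by
  have e := h.map_prod_eq_prod_map_map hU hV
  have : IsProbabilityMeasure (P.map V) := Measure.isProbabilityMeasure_map hV
  have e1 : ∫⁻ a, f (U a, V a) ∂P = ∫⁻ p, f p ∂(P.map fun a => (U a, V a)) :=
    (lintegral_map' hf.aemeasurable (hU.prodMk hV)).symm
  rw [e1, e, lintegral_prod _ hf.aemeasurable,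
    lintegral_map' hf.lintegral_prod_right'.aemeasurable hU]
  refine lintegral_congr fun a => ?_
  exact lintegral_map' (f := fun b => f (U a, b)) (hf.comp measurable_prodMk_left).aemeasurable hV

/-- Integrate out `V` first: if the mean over `V` is `g`, then `f (U, V)` and `g U` have the same
mean. -/
lemma integral_indep_of_nonneg (hU : AEMeasurable U P) (hV : AEMeasurable V P)
    (h : IndepFun U V P) {f : α → β → ℝ} (hf : Measurable fun p : α × β => f p.1 p.2)
    (hf0 : ∀ u v, 0 ≤ f u v) {g : α → ℝ} (hfi : ∀ u, Integrable (fun a => f u (V a)) P)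
    (hg : ∀ u, ∫ a, f u (V a) ∂P = g u) (hgi : Integrable (fun a => g (U a)) P) :
    Integrable (fun a => f (U a) (V a)) P ∧ ∫ a, f (U a) (V a) ∂P = ∫ a, g (U a) ∂P := by
  have hg0 : ∀ u, 0 ≤ g u := fun u => hg u ▸ integral_nonneg fun a => hf0 _ _
  have hm : AEStronglyMeasurable (fun a => f (U a) (V a)) P :=
    (hf.comp_aemeasurable (hU.prodMk hV)).aestronglyMeasurable
  have e : ∫⁻ a, ENNReal.ofReal (f (U a) (V a)) ∂P = ENNReal.ofReal (∫ a, g (U a) ∂P) := by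
    rw [lintegral_indep hU hV h (f := fun p => ENNReal.ofReal (f p.1 p.2)) hf.ennreal_ofReal,
      ofReal_integral_eq_lintegral_ofReal hgi (Filter.Eventually.of_forall fun a => hg0 _)]
    refine lintegral_congr fun a => ?_
    rw [← hg, ofReal_integral_eq_lintegral_ofReal (hfi _)
      (Filter.Eventually.of_forall fun b => hf0 _ _)]
  have hint : Integrable (fun a => f (U a) (V a)) P := by
    refine ⟨hm, ?_⟩
    rw [hasFiniteIntegral_iff_ofReal (Filter.Eventually.of_forall fun a => hf0 _ _), e]
    exact ENNReal.ofReal_lt_top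
  refine ⟨hint, ?_⟩
  rw [← ofReal_integral_eq_lintegral_ofReal hint (Filter.Eventually.of_forall fun a => hf0 _ _),
    ENNReal.ofReal_eq_ofReal_iff (integral_nonneg fun a => hf0 _ _)
      (integral_nonneg fun a => hg0 _)] at e
  exact e

/-- A function of `(U, V)` whose mean over `V` vanishes for each value of `U` has mean zero;
without integrability the integral is zero by convention. -/
lemma integral_indep_eq_zero (hU : AEMeasurable U P) (hV : AEMeasurable V P)
    (h : IndepFun U V P) {f : α → β → ℝ} (hf : Measurable fun p : α × β => f p.1 p.2)
    (hf0 : ∀ u, ∫ a, f u (V a) ∂P = 0) : ∫ a, f (U a) (V a) ∂P = 0 := by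
  by_cases hi : Integrable (fun a => f (U a) (V a)) P
  swap
  · exact integral_undef hi
  have e := h.map_prod_eq_prod_map_map hU hV
  have : IsProbabilityMeasure (P.map V) := Measure.isProbabilityMeasure_map hV
  have : IsProbabilityMeasure (P.map U) := Measure.isProbabilityMeasure_map hU
  have hi' : Integrable (fun p : α × β => f p.1 p.2) ((P.map U).prod (P.map V)) := by
    rw [← e, integrable_map_measure hf.aestronglyMeasurable (hU.prodMk hV)]
    exact hi
  have e2 : ∫ a, f (U a) (V a) ∂P = ∫ p, f p.1 p.2 ∂(P.map fun a => (U a, V a)) :=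
    (integral_map (hU.prodMk hV) hf.aestronglyMeasurable).symm
  rw [e2, e, integral_prod _ hi']
  have : ∀ u, ∫ v, f u v ∂(P.map V) = 0 := fun u => by
    rw [integral_map (f := fun v => f u v) hV
      (hf.comp measurable_prodMk_left).aestronglyMeasurable]
    exact hf0 u
  simp [this]

end Indep

/-! ### Gaussian samples -/

section Sample

variable {d n : ℕ} {Ω : Type*} [MeasurableSpace Ω] {P : Measure Ω} [IsProbabilityMeasure P]

/-- `ξ` is a sample of independent vectors with law `N(m, S)`. -/
structure IsGaussianSample (P : Measure Ω) (ξ : Fin n → Ω → EuclideanSpace ℝ (Fin d))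
    (m : EuclideanSpace ℝ (Fin d)) (S : Matrix (Fin d) (Fin d) ℝ) : Prop where
  posSemidef : S.PosSemidef
  hasLaw : ∀ i, HasLaw (ξ i) (multivariateGaussian m S) P
  indep : iIndepFun ξ P

/-- The mean of a sample. -/
noncomputable def sampleMean (ξ : Fin n → Ω → EuclideanSpace ℝ (Fin d)) (a : Ω) :
    EuclideanSpace ℝ (Fin d) :=
  (1 / (n : ℝ)) • ∑ i, ξ i a

/-- The sample, centred at its own mean. -/
noncomputable def centred (ξ : Fin n → Ω → EuclideanSpace ℝ (Fin d)) (a : Ω) (i : Fin n) :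
    EuclideanSpace ℝ (Fin d) :=
  ξ i a - sampleMean ξ a

lemma centred_gaussian_moments {X : Ω → ℝ} {v : ℝ} (hv : 0 ≤ v)
    (h : HasLaw X (gaussianReal 0 v.toNNReal) P) :
    MemLp X 2 P ∧ ∫ a, X a ∂P = 0 ∧ ∫ a, X a ^ 2 ∂P = v := by
  have hm : MemLp X 2 P := by
    have := memLp_id_gaussianReal (μ := 0) (v := v.toNNReal) 2
    rw [← h.map_eq, memLp_map_measure_iff (by fun_prop) h.aemeasurable] at this
    exact this
  have h0 : ∫ a, X a ∂P = 0 := by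
    rw [h.integral_eq, integral_id_gaussianReal]
  refine ⟨hm, h0, ?_⟩
  have hvar := h.variance_eq
  rw [variance_id_gaussianReal, variance_eq_sub hm, h0, Real.coe_toNNReal _ hv] at hvar
  simpa using hvar

variable {ξ : Fin n → Ω → EuclideanSpace ℝ (Fin d)} {m : EuclideanSpace ℝ (Fin d)}
  {S : Matrix (Fin d) (Fin d) ℝ}

lemma sampleMean_sub (hn : 1 ≤ n) (ξ : Fin n → Ω → EuclideanSpace ℝ (Fin d))
    (m : EuclideanSpace ℝ (Fin d)) (a : Ω) :
    sampleMean ξ a - m = (1 / (n : ℝ)) • ∑ i, (ξ i a - m) := by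
  have hn0 : (n : ℝ) ≠ 0 := by positivity
  rw [Finset.sum_sub_distrib, smul_sub, sampleMean]
  congr 1
  rw [Finset.sum_const, Finset.card_univ, Fintype.card_fin, ← Nat.cast_smul_eq_nsmul ℝ, smul_smul]
  field_simp
  simp

/-- The Pythagorean decomposition of a sum of squares around the sample mean. -/
lemma sum_inner_centred_sq (hn : 1 ≤ n) (ξ : Fin n → Ω → EuclideanSpace ℝ (Fin d))
    (m v : EuclideanSpace ℝ (Fin d)) (a : Ω) :
    ∑ i, inner ℝ v (centred ξ a i) ^ 2
      = ∑ i, inner ℝ v (ξ i a - m) ^ 2 - n * inner ℝ v (sampleMean ξ a - m) ^ 2 := by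
  have hn0 : (n : ℝ) ≠ 0 := by positivity
  have h1 : ∑ i, inner ℝ v (ξ i a - m) = n * inner ℝ v (sampleMean ξ a - m) := by
    rw [sampleMean_sub hn, inner_smul_right, inner_sum]; field_simp
  have h2 : ∀ i, inner ℝ v (centred ξ a i)
      = inner ℝ v (ξ i a - m) - inner ℝ v (sampleMean ξ a - m) := fun i => by
    rw [← inner_sub_right, centred]; congr 1; abel
  simp_rw [h2, sub_sq]
  rw [Finset.sum_add_distrib, Finset.sum_sub_distrib, ← Finset.sum_mul, ← Finset.mul_sum, h1]
  simp; ring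

lemma sum_norm_centred_sq (hn : 1 ≤ n) (ξ : Fin n → Ω → EuclideanSpace ℝ (Fin d))
    (m : EuclideanSpace ℝ (Fin d)) (a : Ω) :
    ∑ i, ‖centred ξ a i‖ ^ 2
      = ∑ i, ‖ξ i a - m‖ ^ 2 - n * ‖sampleMean ξ a - m‖ ^ 2 := by
  have h : ∀ x : EuclideanSpace ℝ (Fin d), ‖x‖ ^ 2
      = ∑ c, inner ℝ (EuclideanSpace.basisFun (Fin d) ℝ c) x ^ 2 := fun x =>
    ((EuclideanSpace.basisFun (Fin d) ℝ).sum_sq_inner_right x).symm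
  simp_rw [h]
  rw [Finset.sum_comm]
  simp_rw [sum_inner_centred_sq hn ξ m]
  rw [Finset.sum_sub_distrib, Finset.sum_comm, Finset.mul_sum]

namespace IsGaussianSample

variable (h : IsGaussianSample P ξ m S)
include h

lemma aemeasurable (i : Fin n) : AEMeasurable (ξ i) P := (h.hasLaw i).aemeasurable

lemma aemeasurable_sampleMean : AEMeasurable (sampleMean ξ) P := by
  have := h.aemeasurable
  unfold sampleMean; fun_prop

lemma aemeasurable_centred : AEMeasurable (centred ξ) P := by
  have := h.aemeasurable
  have := h.aemeasurable_sampleMean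
  refine aemeasurable_pi_lambda _ fun i => ?_
  unfold centred; fun_prop

lemma inner_sub_hasLaw (v : EuclideanSpace ℝ (Fin d)) (i : Fin n) :
    HasLaw (fun a => inner ℝ v (ξ i a - m)) (gaussianReal 0 (quad S v).toNNReal) P := by
  have hm : HasLaw (fun x => inner ℝ v (x - m)) (gaussianReal 0 (quad S v).toNNReal)
      (multivariateGaussian m S) := by
    refine ⟨by fun_prop, ?_⟩
    rw [multivariateGaussian, Measure.map_map (by fun_prop) (by fun_prop),
      ← norm_adjoint_sqrtMap_sq h.posSemidef, ← map_inner_stdGaussian]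
    congr 1
    ext x
    simp [ContinuousLinearMap.adjoint_inner_left, sqrtMap]
  exact hm.fun_comp (h.hasLaw i)

lemma indep_inner (v : EuclideanSpace ℝ (Fin d)) :
    iIndepFun (fun i a => inner ℝ v (ξ i a - m)) P :=
  h.indep.comp (fun _ x => inner ℝ v (x - m)) (fun _ => by fun_prop)

lemma hasGaussianLaw_tuple : HasGaussianLaw (fun a i => ξ i a) P :=
  iIndepFun.hasGaussianLaw (fun i => (h.hasLaw i).hasGaussianLaw) h.indep

lemma inner_sum_hasLaw (v : EuclideanSpace ℝ (Fin d)) (s : Finset (Fin n)) :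
    HasLaw (fun a => inner ℝ v (∑ i ∈ s, (ξ i a - m)))
      (gaussianReal 0 (s.card * quad S v).toNNReal) P := by
  have hq := quad_nonneg h.posSemidef v
  have hm : ∀ i, MemLp (fun a => inner ℝ v (ξ i a - m)) 2 P := fun i =>
    (centred_gaussian_moments hq (h.inner_sub_hasLaw v i)).1
  have h0 : ∀ i, ∫ a, inner ℝ v (ξ i a - m) ∂P = 0 := fun i =>
    (centred_gaussian_moments hq (h.inner_sub_hasLaw v i)).2.1
  have hv : ∀ i, Var[fun a => inner ℝ v (ξ i a - m); P] = quad S v := fun i => by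
    rw [(h.inner_sub_hasLaw v i).variance_eq, variance_id_gaussianReal,
      Real.coe_toNNReal _ hq]
  have hG : HasGaussianLaw (fun a => fun i => inner ℝ v (ξ i a - m)) P :=
    iIndepFun.hasGaussianLaw (fun i => (h.inner_sub_hasLaw v i).hasGaussianLaw) (h.indep_inner v)
  have hG2 : HasGaussianLaw (fun a => inner ℝ v (∑ i ∈ s, (ξ i a - m))) P := by
    have := hG.map_fun (∑ i ∈ s, ContinuousLinearMap.proj (R := ℝ) (φ := fun _ : Fin n => ℝ) i)
    simp_rw [inner_sum]
    simpa using this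
  refine ⟨hG2.aemeasurable, ?_⟩
  rw [hG2.map_eq_gaussianReal]
  have e1 : ∫ a, inner ℝ v (∑ i ∈ s, (ξ i a - m)) ∂P = 0 := by
    simp_rw [inner_sum]
    rw [integral_finsetSum _ fun i _ => (hm i).integrable (by norm_num)]
    simp [h0]
  have e2 : Var[fun a => inner ℝ v (∑ i ∈ s, (ξ i a - m)); P] = s.card * quad S v := by
    have : (fun a => inner ℝ v (∑ i ∈ s, (ξ i a - m)))
        = ∑ i ∈ s, fun a => inner ℝ v (ξ i a - m) := by
      ext a; rw [inner_sum, Finset.sum_apply]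
    rw [this, IndepFun.variance_sum (fun i _ => hm i)
      (fun i _ j _ hij => (h.indep_inner v).indepFun hij)]
    simp [hv]
  rw [e1, e2]

lemma moments_inner_sum (v : EuclideanSpace ℝ (Fin d)) (s : Finset (Fin n)) :
    MemLp (fun a => inner ℝ v (∑ i ∈ s, (ξ i a - m))) 2 P ∧
    ∫ a, inner ℝ v (∑ i ∈ s, (ξ i a - m)) ∂P = 0 ∧
    ∫ a, inner ℝ v (∑ i ∈ s, (ξ i a - m)) ^ 2 ∂P = s.card * quad S v :=
  centred_gaussian_moments (mul_nonneg (Nat.cast_nonneg _) (quad_nonneg h.posSemidef v))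
    (h.inner_sum_hasLaw v s)

lemma moments_inner_sub (v : EuclideanSpace ℝ (Fin d)) (i : Fin n) :
    MemLp (fun a => inner ℝ v (ξ i a - m)) 2 P ∧ ∫ a, inner ℝ v (ξ i a - m) ∂P = 0 ∧
    ∫ a, inner ℝ v (ξ i a - m) ^ 2 ∂P = quad S v :=
  centred_gaussian_moments (quad_nonneg h.posSemidef v) (h.inner_sub_hasLaw v i)

lemma inner_sampleMean_hasLaw (hn : 1 ≤ n) (v : EuclideanSpace ℝ (Fin d)) :
    HasLaw (fun a => inner ℝ v (sampleMean ξ a - m))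
      (gaussianReal 0 (quad S v / n).toNNReal) P := by
  have hn0 : (0 : ℝ) < n := by exact_mod_cast hn
  have := gaussianReal_const_mul (h.inner_sum_hasLaw v Finset.univ) (1 / (n : ℝ))
  simp_rw [sampleMean_sub hn, inner_smul_right]
  convert this using 2
  · simp
  · ext
    have hq := quad_nonneg h.posSemidef v
    rw [NNReal.coe_mul, Real.coe_toNNReal _ (by positivity), Real.coe_toNNReal _ (by positivity)]
    simp; field_simp

lemma moments_inner_sampleMean (hn : 1 ≤ n) (v : EuclideanSpace ℝ (Fin d)) :
    MemLp (fun a => inner ℝ v (sampleMean ξ a - m)) 2 P ∧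
    ∫ a, inner ℝ v (sampleMean ξ a - m) ∂P = 0 ∧
    ∫ a, inner ℝ v (sampleMean ξ a - m) ^ 2 ∂P = quad S v / n :=
  centred_gaussian_moments (div_nonneg (quad_nonneg h.posSemidef v) (Nat.cast_nonneg _))
    (h.inner_sampleMean_hasLaw hn v)

lemma hasGaussianLaw_sampleMean : HasGaussianLaw (sampleMean ξ) P := by
  have := h.hasGaussianLaw_tuple.map_fun ((1 / (n : ℝ)) • ∑ i, ContinuousLinearMap.proj (R := ℝ)
    (φ := fun _ : Fin n => EuclideanSpace ℝ (Fin d)) i)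
  have e : sampleMean ξ = fun a => (1 / (n : ℝ)) • ∑ i, ξ i a := rfl
  rw [e]
  simpa using this

/-- The error of the sample mean is distributed as `A g / √n` with `A` the square root of the
covariance and `g` a standard Gaussian vector. -/
lemma sampleMean_sub_hasLaw (hn : 1 ≤ n) :
    HasLaw (fun a => sampleMean ξ a - m)
      ((stdGaussian (EuclideanSpace ℝ (Fin d))).map fun x => (√(n : ℝ))⁻¹ • sqrtMap S x) P := by
  have hn0 : (0 : ℝ) < n := by exact_mod_cast hn
  have hm := h.aemeasurable_sampleMean
  have hAm : Measurable fun x : EuclideanSpace ℝ (Fin d) => (√(n : ℝ))⁻¹ • sqrtMap S x := by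
    fun_prop
  refine ⟨by fun_prop, ?_⟩
  have : IsProbabilityMeasure (P.map fun a => sampleMean ξ a - m) :=
    Measure.isProbabilityMeasure_map (by fun_prop)
  have : IsProbabilityMeasure
      ((stdGaussian (EuclideanSpace ℝ (Fin d))).map fun x => (√(n : ℝ))⁻¹ • sqrtMap S x) :=
    Measure.isProbabilityMeasure_map hAm.aemeasurable
  have hext : ∀ (μ ν : Measure (EuclideanSpace ℝ (Fin d))) [IsProbabilityMeasure μ]
      [IsProbabilityMeasure ν], (∀ t, μ.map (fun x => inner ℝ t x) = ν.map fun x => inner ℝ t x) →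
      μ = ν := by
    intro μ ν _ _ hmap
    refine Measure.ext_of_charFun (funext fun t => ?_)
    have e : ∀ κ : Measure (EuclideanSpace ℝ (Fin d)),
        charFun κ t = charFun (κ.map fun x => inner ℝ t x) 1 := by
      intro κ
      rw [charFun_apply, charFun_apply, integral_map (by fun_prop) (by fun_prop)]
      congr 1; ext x
      rw [real_inner_comm x t]; simp
    rw [e, e, hmap t]
  refine hext _ _ fun t => ?_
  rw [AEMeasurable.map_map_of_aemeasurable (by fun_prop) (by fun_prop),
    Measure.map_map (by fun_prop) hAm]
  refine (h.inner_sampleMean_hasLaw hn t).map_eq.trans ?_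
  have e : ((fun x => inner ℝ t x) ∘ fun x : EuclideanSpace ℝ (Fin d) =>
      (√(n : ℝ))⁻¹ • sqrtMap S x) = innerSL ℝ ((√(n : ℝ))⁻¹ • (sqrtMap S).adjoint t) := by
    ext x
    simp [inner_smul_right, ContinuousLinearMap.adjoint_inner_left]
  rw [e, map_inner_stdGaussian, norm_smul, mul_pow, norm_adjoint_sqrtMap_sq h.posSemidef]
  congr 2
  rw [Real.norm_eq_abs, sq_abs, inv_pow, Real.sq_sqrt hn0.le]
  field_simp

/-- The sample mean is independent of the centred sample: they are jointly Gaussian and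
uncorrelated. -/
lemma indepFun_sampleMean_centred (hn : 1 ≤ n) :
    IndepFun (fun a => sampleMean ξ a - m) (centred ξ) P := by
  have hn0 : (0 : ℝ) < n := by exact_mod_cast hn
  have hc : HasGaussianLaw (fun a => (sampleMean ξ a, centred ξ a)) P := by
    let M : (Fin n → EuclideanSpace ℝ (Fin d)) →L[ℝ] EuclideanSpace ℝ (Fin d) :=
      (1 / (n : ℝ)) • ∑ i, ContinuousLinearMap.proj (R := ℝ)
        (φ := fun _ : Fin n => EuclideanSpace ℝ (Fin d)) i
    have := h.hasGaussianLaw_tuple.map_fun (M.prod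
      (ContinuousLinearMap.pi fun i => ContinuousLinearMap.proj (R := ℝ)
        (φ := fun _ : Fin n => EuclideanSpace ℝ (Fin d)) i - M))
    have e : (fun a => (sampleMean ξ a, centred ξ a)) = fun a => M.prod
        (ContinuousLinearMap.pi fun i => ContinuousLinearMap.proj (R := ℝ)
          (φ := fun _ : Fin n => EuclideanSpace ℝ (Fin d)) i - M) fun i => ξ i a := by
      ext1 a
      refine Prod.ext ?_ (funext fun i => ?_)
      · simp [M, sampleMean]
      · simp [M, sampleMean, centred]
    rw [e]
    exact this
  have hind : IndepFun (sampleMean ξ) (centred ξ) P := by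
    refine hc.indepFun_of_covariance_strongDual fun L₁ L₂ => ?_
    -- the covariance of two functionals of the sample vanishes off the diagonal
    have hL : ∀ (L : StrongDual ℝ (EuclideanSpace ℝ (Fin d))) i, MemLp (fun a => L (ξ i a)) 2 P :=
      fun L i => ((h.hasLaw i).hasGaussianLaw.map_fun L).memLp_two
    set κ : StrongDual ℝ (EuclideanSpace ℝ (Fin d)) → ℝ := fun L =>
      cov[fun x => L₁ x, fun x => L x; multivariateGaussian m S] with hκ
    have hcov : ∀ L i j, cov[fun a => L₁ (ξ i a), fun a => L (ξ j a); P]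
        = if i = j then κ L else 0 := by
      intro L i j
      split_ifs with hij
      · subst hij
        exact (h.hasLaw i).covariance_fun_comp (f := fun x => L₁ x) (g := fun x => L x)
          (by fun_prop) (by fun_prop)
      · exact ((h.indep.indepFun hij).comp (φ := fun x => L₁ x) (ψ := fun x => L x)
          (by fun_prop) (by fun_prop)).covariance_eq_zero (hL _ _) (hL _ _)
    set l : Fin n → StrongDual ℝ (EuclideanSpace ℝ (Fin d)) := fun j =>
      L₂.comp (ContinuousLinearMap.single ℝ (fun _ : Fin n => EuclideanSpace ℝ (Fin d)) j) with hl
    have e1 : L₁ ∘ sampleMean ξ = fun a => ∑ i, (1 / (n : ℝ)) * L₁ (ξ i a) := by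
      ext a; simp [sampleMean, Finset.mul_sum]
    have e2 : L₂ ∘ centred ξ = fun a => ∑ j, (l j (ξ j a) - ∑ i, (1 / (n : ℝ)) * l j (ξ i a)) := by
      ext a
      have : centred ξ a = ∑ j, Pi.single j (centred ξ a j) :=
        (Finset.univ_sum_single (centred ξ a)).symm
      rw [Function.comp_apply, this, map_sum]
      refine Finset.sum_congr rfl fun j _ => ?_
      have : L₂ (Pi.single j (centred ξ a j)) = l j (centred ξ a j) := by simp [hl]
      rw [this, centred, map_sub, sampleMean, map_smul, map_sum, smul_eq_mul, Finset.mul_sum]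
    have hm1 : ∀ (L : StrongDual ℝ (EuclideanSpace ℝ (Fin d))) i,
        MemLp (fun a => (1 / (n : ℝ)) * L (ξ i a)) 2 P := fun L i => (hL L i).const_mul _
    rw [e1, e2, covariance_fun_sum_fun_sum (X := fun i a => (1 / (n : ℝ)) * L₁ (ξ i a))
      (Y := fun j a => l j (ξ j a) - ∑ i, (1 / (n : ℝ)) * l j (ξ i a)) (hm1 L₁)
      (fun j => (hL _ _).sub (memLp_finsetSum _ fun i _ => hm1 _ i)), Finset.sum_comm]
    refine Finset.sum_eq_zero fun j _ => ?_
    have e3 : ∀ i, cov[fun a => (1 / (n : ℝ)) * L₁ (ξ i a),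
        fun a => l j (ξ j a) - ∑ i, (1 / (n : ℝ)) * l j (ξ i a); P]
        = (1 / n) * (if i = j then κ (l j) else 0) - (1 / n) * ((1 / n) * κ (l j)) := by
      intro i
      rw [covariance_const_mul_left, covariance_fun_sub_right (hL _ _) (hL _ _)
        (memLp_finsetSum _ fun i _ => hm1 _ i), hcov, covariance_fun_sum_right
        (fun i => hm1 _ i) (hL _ _)]
      simp_rw [covariance_const_mul_right, hcov]
      simp [mul_sub]
    simp_rw [e3]
    simp [Finset.sum_sub_distrib]
    field_simp
    simp
  exact hind.comp (φ := fun x => x - m) (ψ := id) (by fun_prop) measurable_id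

end IsGaussianSample

end Sample

/-! ### Moments of a Gaussian sample -/

section Moments

variable {d n : ℕ} {Ω : Type*} [MeasurableSpace Ω] {P : Measure Ω} [IsProbabilityMeasure P]

lemma integral_abs_le_sqrt {X : Ω → ℝ} (hX : MemLp X 2 P) :
    ∫ a, |X a| ∂P ≤ √(∫ a, X a ^ 2 ∂P) := by
  refine Real.le_sqrt_of_sq_le ?_
  have h := variance_nonneg (fun a => |X a|) P
  rw [variance_eq_sub (X := fun a => |X a|) hX.abs] at h
  simpa using h

lemma quad_smul_left (c : ℝ) (S : Matrix (Fin d) (Fin d) ℝ) (v : EuclideanSpace ℝ (Fin d)) :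
    quad (c • S) v = c * quad S v := by
  simp [quad, Matrix.smul_mulVec, dotProduct_smul]

variable {ξ : Fin n → Ω → EuclideanSpace ℝ (Fin d)} {m : EuclideanSpace ℝ (Fin d)}
  {S : Matrix (Fin d) (Fin d) ℝ}

namespace IsGaussianSample

variable (h : IsGaussianSample P ξ m S)
include h

lemma integral_quad_sum (s : Finset (Fin n)) :
    Integrable (fun a => quad S (∑ i ∈ s, (ξ i a - m))) P ∧
    ∫ a, quad S (∑ i ∈ s, (ξ i a - m)) ∂P = s.card * (S * S).trace := by
  have := integral_quad (P := P) h.posSemidef (W := fun a => ∑ i ∈ s, (ξ i a - m)) (Δ := 0)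
    (R := (s.card : ℝ) • S) (fun v => (h.moments_inner_sum v s).1.integrable_sq)
    (fun v => by rw [(h.moments_inner_sum v s).2.2, quad_smul_left]; simp)
  refine ⟨this.1, this.2.trans ?_⟩
  simp [quad, Matrix.trace_smul]

/-- The second moment of the degenerate U-statistic `∑ i ≠ j, ⟨ξ i - m, ξ j - m⟩`, by adding the
observations one at a time: each increment has conditional mean zero given the past. -/
lemma moments_uStat (s : Finset (Fin n)) :
    MemLp (fun a => ‖∑ i ∈ s, (ξ i a - m)‖ ^ 2 - ∑ i ∈ s, ‖ξ i a - m‖ ^ 2) 2 P ∧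
    ∫ a, (‖∑ i ∈ s, (ξ i a - m)‖ ^ 2 - ∑ i ∈ s, ‖ξ i a - m‖ ^ 2) ^ 2 ∂P
      = 2 * s.card * (s.card - 1) * (S * S).trace := by
  classical
  have hm := h.aemeasurable
  induction s using Finset.induction_on with
  | empty => simp
  | insert i s hi ih =>
    obtain ⟨ih1, ih2⟩ := ih
    set U : Ω → (s → EuclideanSpace ℝ (Fin d)) := fun a j => ξ j a with hU
    have hUm : AEMeasurable U P := aemeasurable_pi_lambda _ fun j => hm j
    have hind : IndepFun U (ξ i) P :=
      (h.indep.indepFun_finset₀ s {i} (by simpa using hi) hm).comp (φ := id)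
        (ψ := fun x : (({i} : Finset (Fin n)) → EuclideanSpace ℝ (Fin d)) => x ⟨i, by simp⟩)
        measurable_id (by fun_prop)
    set T : (s → EuclideanSpace ℝ (Fin d)) → EuclideanSpace ℝ (Fin d) := fun x => ∑ j, (x j - m)
      with hT
    set G : (s → EuclideanSpace ℝ (Fin d)) → ℝ := fun x => ‖T x‖ ^ 2 - ∑ j, ‖x j - m‖ ^ 2 with hG
    have hTU : ∀ a, T (U a) = ∑ i ∈ s, (ξ i a - m) := fun a =>
      Finset.sum_coe_sort s fun j => ξ j a - m
    have hGU : ∀ a, G (U a) = ‖∑ i ∈ s, (ξ i a - m)‖ ^ 2 - ∑ i ∈ s, ‖ξ i a - m‖ ^ 2 := by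
      intro a
      simp only [hG, hTU]
      congr 1
      exact Finset.sum_coe_sort s fun j => ‖ξ j a - m‖ ^ 2
    have hTm : Measurable T := by fun_prop
    have hGm : Measurable G := by fun_prop
    have hq := h.integral_quad_sum s
    simp_rw [← hTU] at hq
    simp_rw [← hGU] at ih1 ih2
    have hsq := integral_indep_of_nonneg hUm (hm i) hind
      (f := fun x y => inner ℝ (T x) (y - m) ^ 2) (g := fun x => quad S (T x))
      (by fun_prop) (fun _ _ => sq_nonneg _)
      (fun x => (h.moments_inner_sub (T x) i).1.integrable_sq)
      (fun x => (h.moments_inner_sub (T x) i).2.2) hq.1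
    have hcross : ∫ a, G (U a) * inner ℝ (T (U a)) (ξ i a - m) ∂P = 0 :=
      integral_indep_eq_zero hUm (hm i) hind
        (f := fun x y => G x * inner ℝ (T x) (y - m)) (by fun_prop) (fun x => by
          rw [integral_const_mul, (h.moments_inner_sub (T x) i).2.1, mul_zero])
    have hHm : MemLp (fun a => inner ℝ (T (U a)) (ξ i a - m)) 2 P :=
      (memLp_two_iff_integrable_sq
        (by have := hm i; exact AEMeasurable.aestronglyMeasurable (by fun_prop))).2 hsq.1
    have e : ∀ a, ‖∑ j ∈ insert i s, (ξ j a - m)‖ ^ 2 - ∑ j ∈ insert i s, ‖ξ j a - m‖ ^ 2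
        = G (U a) + 2 * inner ℝ (T (U a)) (ξ i a - m) := by
      intro a
      rw [Finset.sum_insert hi, Finset.sum_insert hi, hGU, hTU, norm_add_sq_real,
        real_inner_comm (ξ i a - m)]
      ring
    simp_rw [e]
    refine ⟨ih1.add (hHm.const_mul 2), ?_⟩
    have e2 : ∀ a, (G (U a) + 2 * inner ℝ (T (U a)) (ξ i a - m)) ^ 2
        = G (U a) ^ 2 + 4 * (G (U a) * inner ℝ (T (U a)) (ξ i a - m))
          + 4 * inner ℝ (T (U a)) (ξ i a - m) ^ 2 := fun a => by ring
    have hGH : Integrable (fun a => G (U a) * inner ℝ (T (U a)) (ξ i a - m)) P :=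
      ih1.integrable_mul hHm
    simp_rw [e2]
    rw [integral_add (f := fun a => G (U a) ^ 2 + 4 * (G (U a) * inner ℝ (T (U a)) (ξ i a - m)))
        (ih1.integrable_sq.add (hGH.const_mul 4)) (hsq.1.const_mul 4),
      integral_add ih1.integrable_sq (hGH.const_mul 4), integral_const_mul, integral_const_mul,
      hcross, hsq.2, hq.2, ih2, Finset.card_insert_of_notMem hi]
    push_cast
    ring

/-- The squared error of the sample mean minus its unbiased estimator is a degenerate
U-statistic. -/
lemma integral_abs_norm_sq_sub_le (hn : 2 ≤ n) :
    Integrable (fun a => |‖sampleMean ξ a - m‖ ^ 2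
      - 1 / ((n : ℝ) * ((n : ℝ) - 1)) * ∑ i, ‖centred ξ a i‖ ^ 2|) P ∧
    ∫ a, |‖sampleMean ξ a - m‖ ^ 2
      - 1 / ((n : ℝ) * ((n : ℝ) - 1)) * ∑ i, ‖centred ξ a i‖ ^ 2| ∂P
      ≤ 2 * (√((S * S).trace) / n) := by
  have hn2 : (2 : ℝ) ≤ n := by exact_mod_cast hn
  have hn0 : (0 : ℝ) < n := by linarith
  have hn1 : (0 : ℝ) < n - 1 := by linarith
  have hn1' : (n : ℝ) - 1 ≠ 0 := hn1.ne'
  obtain ⟨h1, h2⟩ := h.moments_uStat Finset.univ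
  have e : ∀ a, ‖sampleMean ξ a - m‖ ^ 2
      - 1 / ((n : ℝ) * ((n : ℝ) - 1)) * ∑ i, ‖centred ξ a i‖ ^ 2
      = 1 / ((n : ℝ) * ((n : ℝ) - 1)) *
        (‖∑ i, (ξ i a - m)‖ ^ 2 - ∑ i, ‖ξ i a - m‖ ^ 2) := by
    intro a
    have hs : ‖∑ i, (ξ i a - m)‖ ^ 2 = n ^ 2 * ‖sampleMean ξ a - m‖ ^ 2 := by
      rw [sampleMean_sub (by omega), norm_smul, mul_pow]
      simp; field_simp
    rw [sum_norm_centred_sq (by omega) ξ m, hs]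
    field_simp
    ring
  have hmem := h1.const_mul (1 / ((n : ℝ) * ((n : ℝ) - 1)))
  simp_rw [e]
  refine ⟨(hmem.integrable (by norm_num)).abs, (integral_abs_le_sqrt hmem).trans ?_⟩
  have htr := trace_mul_self_nonneg h.posSemidef
  have e2 : ∫ a, (1 / ((n : ℝ) * ((n : ℝ) - 1)) *
        (‖∑ i, (ξ i a - m)‖ ^ 2 - ∑ i, ‖ξ i a - m‖ ^ 2)) ^ 2 ∂P
      = 2 / (n * (n - 1)) * (S * S).trace := by
    simp_rw [mul_pow]
    rw [integral_const_mul, h2, Finset.card_univ, Fintype.card_fin]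
    field_simp
  rw [e2]
  refine Real.sqrt_le_iff.2 ⟨by positivity, ?_⟩
  rw [mul_pow, div_pow, Real.sq_sqrt htr]
  have : 2 / ((n : ℝ) * (n - 1)) ≤ 4 / n ^ 2 := by
    rw [div_le_div_iff₀ (by positivity) (by positivity)]
    nlinarith
  calc 2 / ((n : ℝ) * (n - 1)) * (S * S).trace ≤ 4 / n ^ 2 * (S * S).trace := by gcongr
    _ = _ := by ring

lemma integral_sampleVar (hn : 2 ≤ n) (v : EuclideanSpace ℝ (Fin d)) :
    Integrable (fun a => sampleVar (centred ξ a) v) P ∧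
    ∫ a, sampleVar (centred ξ a) v ∂P = quad S v := by
  have hn2 : (2 : ℝ) ≤ n := by exact_mod_cast hn
  have hn1 : (n : ℝ) - 1 ≠ 0 := by linarith
  have hn0 : (n : ℝ) ≠ 0 := by linarith
  obtain ⟨h1, -, h2⟩ := h.moments_inner_sampleMean (by omega) v
  have hi : Integrable (fun a => ∑ i, inner ℝ v (ξ i a - m) ^ 2) P :=
    integrable_finsetSum _ fun i _ => (h.moments_inner_sub v i).1.integrable_sq
  unfold sampleVar
  simp_rw [sum_inner_centred_sq (show 1 ≤ n by omega) ξ m]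
  refine ⟨(hi.sub (h1.integrable_sq.const_mul _)).const_mul _, ?_⟩
  rw [integral_const_mul, integral_sub hi (h1.integrable_sq.const_mul _), integral_const_mul, h2,
    integral_finsetSum _ fun i _ => (h.moments_inner_sub v i).1.integrable_sq]
  simp_rw [(h.moments_inner_sub v _).2.2]
  simp
  field_simp

end IsGaussianSample

/-! ### The lower tail of the sample variance -/

lemma integral_exp_neg_sq_gaussian {X : Ω → ℝ} {v : ℝ} (hv : 0 < v)
    (hX : HasLaw X (gaussianReal 0 v.toNNReal) P) :
    ∫ a, Real.exp (-(4 / v) * X a ^ 2) ∂P = 1 / 3 := by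
  have e : ∫ a, Real.exp (-(4 / v) * X a ^ 2) ∂P
      = ∫ x, Real.exp (-(4 / v) * x ^ 2) ∂(gaussianReal 0 v.toNNReal) :=
    hX.integral_comp (f := fun x => Real.exp (-(4 / v) * x ^ 2))
      (Measurable.aestronglyMeasurable (by fun_prop))
  have hv' : v.toNNReal ≠ 0 := by simpa using hv
  rw [e, integral_gaussianReal_eq_integral_smul hv']
  have e2 : ∀ x : ℝ, gaussianPDFReal 0 v.toNNReal x • Real.exp (-(4 / v) * x ^ 2)
      = (√(2 * Real.pi * v))⁻¹ * Real.exp (-(9 / (2 * v)) * x ^ 2) := by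
    intro x
    rw [gaussianPDFReal, Real.coe_toNNReal _ hv.le, smul_eq_mul, mul_assoc, ← Real.exp_add]
    congr 2
    field_simp; ring
  simp_rw [e2]
  rw [integral_const_mul, integral_gaussian, ← Real.sqrt_inv, ← Real.sqrt_mul (by positivity)]
  have : (2 * Real.pi * v)⁻¹ * (Real.pi / (9 / (2 * v))) = (1 / 3) ^ 2 := by
    field_simp; norm_num
  rw [this, Real.sqrt_sq (by norm_num)]

/-- The Laplace transform of the centred sum of squares: by independence of the sample mean and the
centred sample it is the quotient of those of the sum of all squares and of the squared mean. -/
lemma IsGaussianSample.integral_exp_neg_sum_centred (h : IsGaussianSample P ξ m S) (hn : 1 ≤ n)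
    {v : EuclideanSpace ℝ (Fin d)} (hq : 0 < quad S v) :
    ∫ a, Real.exp (-(4 / quad S v) * ∑ i, inner ℝ v (centred ξ a i) ^ 2) ∂P
      = (1 / 3) ^ (n - 1) := by
  have hn0 : (0 : ℝ) < n := by exact_mod_cast hn
  have hmc := h.aemeasurable_centred
  have hmm := h.aemeasurable_sampleMean
  set σ := quad S v with hσ
  have hφ : Measurable fun x : EuclideanSpace ℝ (Fin d) =>
      Real.exp (-(4 / (σ / n)) * inner ℝ v x ^ 2) := by fun_prop
  have hψ : Measurable fun Y : Fin n → EuclideanSpace ℝ (Fin d) =>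
      Real.exp (-(4 / σ) * ∑ i, inner ℝ v (Y i) ^ 2) := by fun_prop
  have h1 : ∫ a, ∏ i, Real.exp (-(4 / σ) * inner ℝ v (ξ i a - m) ^ 2) ∂P = (1 / 3) ^ n := by
    have hind : iIndepFun (fun i a => Real.exp (-(4 / σ) * inner ℝ v (ξ i a - m) ^ 2)) P :=
      (h.indep_inner v).comp (fun _ x => Real.exp (-(4 / σ) * x ^ 2)) (fun _ => by fun_prop)
    rw [hind.integral_fun_prod_eq_prod_integral (fun i => by
      have := h.aemeasurable i
      exact AEMeasurable.aestronglyMeasurable (by fun_prop))]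
    simp_rw [integral_exp_neg_sq_gaussian hq (h.inner_sub_hasLaw v _)]
    simp
  have h2 : ∫ a, Real.exp (-(4 / (σ / n)) * inner ℝ v (sampleMean ξ a - m) ^ 2) ∂P = 1 / 3 :=
    integral_exp_neg_sq_gaussian (by positivity) (h.inner_sampleMean_hasLaw hn v)
  have hind := (h.indepFun_sampleMean_centred hn).comp hφ hψ
  have h3 := hind.integral_fun_mul_eq_mul_integral
    (hφ.comp_aemeasurable (hmm.sub_const m)).aestronglyMeasurable
    (hψ.comp_aemeasurable hmc).aestronglyMeasurable
  simp only [Function.comp_def] at h3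
  rw [h2] at h3
  have h4 : ∀ a, ∏ i, Real.exp (-(4 / σ) * inner ℝ v (ξ i a - m) ^ 2)
      = Real.exp (-(4 / (σ / n)) * inner ℝ v (sampleMean ξ a - m) ^ 2)
        * Real.exp (-(4 / σ) * ∑ i, inner ℝ v (centred ξ a i) ^ 2) := by
    intro a
    rw [← Real.exp_sum, ← Real.exp_add, ← Finset.mul_sum, sum_inner_centred_sq hn ξ m]
    congr 1
    field_simp
    ring
  simp_rw [h4] at h1
  rw [h3] at h1
  have : ((1 : ℝ) / 3) ^ n = 1 / 3 * (1 / 3) ^ (n - 1) := by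
    rw [← pow_succ']; congr 1; omega
  rw [this] at h1
  exact mul_left_cancel₀ (by norm_num) h1

/-- The sample variance in a fixed direction is at least `1/32` of the variance, except on an event
of exponentially small probability. -/
lemma IsGaussianSample.measure_sampleVar_lt_le (h : IsGaussianSample P ξ m S) (hn : 2 ≤ n) {u : ℝ}
    (hu : u ≤ ((n : ℝ) - 1) / 2) (v : EuclideanSpace ℝ (Fin d)) :
    P.real {a | sampleVar (centred ξ a) v < quad S v / 32} ≤ Real.exp (-u) := by
  have hn2 : (2 : ℝ) ≤ n := by exact_mod_cast hn
  have hn1 : (0 : ℝ) < n - 1 := by linarith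
  obtain hq | hq := (quad_nonneg h.posSemidef v).eq_or_lt
  · have : {a | sampleVar (centred ξ a) v < quad S v / 32} = ∅ := by
      ext a
      simpa [← hq] using sampleVar_nonneg (by omega) (centred ξ a) v
    rw [this]; simp [Real.exp_nonneg]
  have h5 := h.integral_exp_neg_sum_centred (by omega) hq
  set σ := quad S v with hσ
  set R : Ω → ℝ := fun a => ∑ i, inner ℝ v (centred ξ a i) ^ 2 with hR
  have hi : Integrable (fun a => Real.exp (-(4 / σ) * R a)) P := by
    by_contra hc
    rw [integral_undef hc] at h5
    have : (0 : ℝ) < (1 / 3) ^ (n - 1) := by positivity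
    linarith
  -- Chernoff's bound at the exponent `4 / σ`, where each square has Laplace transform `1 / 3`
  have hM := mul_meas_ge_le_integral_of_nonneg (μ := P)
    (f := fun a => Real.exp (-(4 / σ) * R a))
    (Filter.Eventually.of_forall fun a => Real.exp_nonneg _) hi (Real.exp (-((n - 1) / 8)))
  have hsub : {a | sampleVar (centred ξ a) v < σ / 32}
      ⊆ {a | Real.exp (-((n - 1) / 8)) ≤ Real.exp (-(4 / σ) * R a)} := by
    intro a ha
    simp only [Set.mem_ofPred_eq, sampleVar] at ha ⊢
    rw [Real.exp_le_exp, neg_mul, neg_le_neg_iff, div_mul_eq_mul_div, div_le_iff₀ hq]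
    rw [one_div_mul_eq_div, div_lt_iff₀ hn1] at ha
    have : R a = ∑ i, inner ℝ v (centred ξ a i) ^ 2 := rfl
    rw [this]; linarith
  refine (measureReal_mono hsub).trans ?_
  rw [h5] at hM
  have hcast : ((n - 1 : ℕ) : ℝ) = n - 1 := by rw [Nat.cast_sub (by omega)]; simp
  have h3le : ((1 : ℝ) / 3) ^ (n - 1) ≤ Real.exp (-(5 / 8 * (n - 1))) := by
    have h38 : (1 : ℝ) / 3 ≤ Real.exp (-(5 / 8)) := by
      rw [Real.exp_neg, one_div]
      refine inv_anti₀ (Real.exp_pos _) ?_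
      calc Real.exp (5 / 8) ≤ Real.exp 1 := Real.exp_le_exp.2 (by norm_num)
        _ ≤ 3 := by linarith [Real.exp_one_lt_d9]
    calc ((1 : ℝ) / 3) ^ (n - 1) ≤ Real.exp (-(5 / 8)) ^ (n - 1) := by gcongr
      _ = _ := by rw [← Real.exp_nat_mul, hcast]; congr 1; ring
  have hfin : Real.exp (-((n - 1) / 8)) *
      P.real {a | Real.exp (-(((n : ℝ) - 1) / 8)) ≤ Real.exp (-(4 / σ) * R a)}
      ≤ Real.exp (-(((n : ℝ) - 1) / 8)) * Real.exp (-u) := by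
    refine hM.trans (h3le.trans ?_)
    rw [← Real.exp_add, Real.exp_le_exp]
    linarith
  exact le_of_mul_le_mul_left hfin (Real.exp_pos _)

end Moments

/-! ### The deterministic oracle inequality -/

section Deterministic

variable {d B : ℕ} {N : Fin B → ℕ} [NeZero B]

/-- The deviations `naive x k - c` of the other naive estimators from the point `c`; the target task
gets deviation zero, so that sums over the other tasks may run over all tasks. -/
noncomputable def deviation (x : Dataset d B N) (c : EuclideanSpace ℝ (Fin d)) (k : Fin B) :
    EuclideanSpace ℝ (Fin d) :=
  if k = 0 then 0 else naive x k - c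

lemma sqrt_sampleVar_add_le {n : ℕ} (Y : Fin n → EuclideanSpace ℝ (Fin d))
    (v w : EuclideanSpace ℝ (Fin d)) :
    √(sampleVar Y (v + w) / n) ≤ √(sampleVar Y v / n) + √(sampleVar Y w / n) := by
  set z : EuclideanSpace ℝ (Fin d) → EuclideanSpace ℝ (Fin n) := fun v =>
    WithLp.toLp 2 fun i => inner ℝ v (Y i) with hz
  obtain hn | hn := Nat.eq_zero_or_pos n
  · subst hn; simp [sampleVar]
  have hn1 : (1 : ℝ) ≤ n := by exact_mod_cast hn
  have h : ∀ v, √(sampleVar Y v / n) = √(1 / ((n : ℝ) - 1) / n) * ‖z v‖ := by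
    intro v
    rw [← Real.sqrt_sq (norm_nonneg (z v)), ← Real.sqrt_mul
      (div_nonneg (div_nonneg zero_le_one (by linarith)) (by linarith)),
      EuclideanSpace.real_norm_sq_eq, sampleVar]
    congr 1
    simp only [hz]; ring
  have hadd : z (v + w) = z v + z w := by
    ext i; simp [hz, inner_add_left]
  rw [h, h, h, hadd, ← mul_add]
  exact mul_le_mul_of_nonneg_left (norm_add_le _ _) (Real.sqrt_nonneg _)

variable (x : Dataset d B N) (c : EuclideanSpace ℝ (Fin d))

lemma aggregate_sub_eq {w : Fin B → ℝ} (hw : w ∈ stdSimplex ℝ (Fin B)) :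
    aggregate x w - c = w 0 • (naive x 0 - c) + ∑ k, w k • deviation x c k := by
  have h1 : c = ∑ k, w k • c := by rw [← Finset.sum_smul, hw.2, one_smul]
  have h2 : aggregate x w - c = ∑ k, w k • (naive x k - c) := by
    conv_lhs => rw [h1]
    rw [aggregate, ← Finset.sum_sub_distrib]
    simp_rw [smul_sub]
  rw [h2, ← Finset.add_sum_erase _ _ (Finset.mem_univ 0),
    ← Finset.add_sum_erase _ (fun k => w k • deviation x c k) (Finset.mem_univ 0)]
  simp only [deviation, if_true, smul_zero, zero_add]
  congr 1
  refine Finset.sum_congr rfl fun k hk => ?_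
  rw [if_neg (Finset.ne_of_mem_erase hk)]

/-- The loss and its empirical version differ by a multiple of the error of `naiveRiskHat` and by
the noise in the direction of the aggregated deviation. -/
lemma norm_aggregate_sub_sq {w : Fin B → ℝ} (hw : w ∈ stdSimplex ℝ (Fin B)) :
    ‖aggregate x w - c‖ ^ 2 = lossHat x w
      + (2 * w 0 - 1) * (‖naive x 0 - c‖ ^ 2 - naiveRiskHat x)
      + 2 * inner ℝ (naive x 0 - c) (∑ k, w k • deviation x c k) := by
  set e := naive x 0 - c with he
  set Z := ∑ k, w k • deviation x c k with hZ
  have h1 : ∑ k ∈ Finset.univ.erase 0, w k • (naive x k - naive x 0) = Z - (1 - w 0) • e := by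
    have hs : ∑ k ∈ Finset.univ.erase 0, w k = 1 - w 0 := by
      rw [← hw.2, ← Finset.add_sum_erase _ _ (Finset.mem_univ 0)]; ring
    rw [hZ, ← Finset.add_sum_erase _ (fun k => w k • deviation x c k) (Finset.mem_univ 0), ← hs,
      Finset.sum_smul]
    simp only [deviation, if_true, smul_zero, zero_add]
    rw [← Finset.sum_sub_distrib]
    refine Finset.sum_congr rfl fun k hk => ?_
    rw [if_neg (Finset.ne_of_mem_erase hk), ← smul_sub, he]
    congr 1; abel
  rw [lossHat, h1, aggregate_sub_eq x c hw, norm_add_sq_real, norm_sub_sq_real, norm_smul,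
    norm_smul, mul_pow, mul_pow, Real.norm_eq_abs, Real.norm_eq_abs, sq_abs, sq_abs,
    inner_smul_left, inner_smul_right, real_inner_comm Z e]
  simp only [RCLike.conj_to_real]
  ring

lemma qHat_eq_sampleVar {k : Fin B} (hk : k ≠ 0) :
    qHat x k = sampleVar (fun i => x 0 i - naive x 0) (naive x 0 - c - deviation x c k) := by
  rw [qHat, sampleVar, deviation, if_neg hk]
  simp

lemma penaltyHat_nonneg {w : Fin B → ℝ} (hw : w ∈ stdSimplex ℝ (Fin B)) : 0 ≤ penaltyHat x w :=
  Finset.sum_nonneg fun k _ => mul_nonneg (hw.1 k) (Real.sqrt_nonneg _)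

lemma le_penaltyHat {w : Fin B → ℝ} (hw : w ∈ stdSimplex ℝ (Fin B)) :
    ∑ k, w k * √(sampleVar (fun i => x 0 i - naive x 0) (deviation x c k) / N 0)
      ≤ penaltyHat x w + √(sampleVar (fun i => x 0 i - naive x 0) (naive x 0 - c) / N 0) := by
  set Y := fun i => x 0 i - naive x 0 with hY
  set r := √(sampleVar Y (naive x 0 - c) / N 0) with hr
  have hneg : ∀ v, sampleVar Y (-v) = sampleVar Y v := fun v => by simp [sampleVar]
  have hk : ∀ k ∈ Finset.univ.erase (0 : Fin B), w k * √(sampleVar Y (deviation x c k) / N 0)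
      ≤ w k * √(qHat x k / N 0) + w k * r := by
    intro k hk
    rw [qHat_eq_sampleVar x c (Finset.ne_of_mem_erase hk), ← mul_add]
    refine mul_le_mul_of_nonneg_left ?_ (hw.1 k)
    have := sqrt_sampleVar_add_le Y (-(naive x 0 - c - deviation x c k)) (naive x 0 - c)
    rw [hneg] at this
    refine le_trans (le_of_eq ?_) this
    congr 3; abel
  have h0 : w 0 * √(sampleVar Y (deviation x c 0) / N 0) = 0 := by
    simp [deviation, sampleVar]
  rw [← Finset.add_sum_erase _ _ (Finset.mem_univ 0), h0, zero_add]
  refine (Finset.sum_le_sum hk).trans ?_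
  rw [Finset.sum_add_distrib, ← Finset.sum_mul]
  have hs : ∑ k ∈ Finset.univ.erase 0, w k ≤ 1 := by
    rw [← hw.2]
    exact Finset.sum_le_sum_of_subset_of_nonneg (Finset.erase_subset _ _) fun k _ _ => hw.1 k
  have := mul_le_mul_of_nonneg_right hs (Real.sqrt_nonneg (sampleVar Y (naive x 0 - c) / N 0))
  rw [penaltyHat]
  linarith

/-- The oracle inequality for a fixed data set: the loss of the selected weights is at most that of
any other weights, up to empirical error terms and the noise excess. -/
lemma loss_le {u η : ℝ} (hη : 0 ≤ η) {v w : Fin B → ℝ} (hv : IsQAggregationWeight u x v)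
    (hw : w ∈ stdSimplex ℝ (Fin B)) :
    (1 - η) * ‖aggregate x v - c‖ ^ 2 ≤ ‖aggregate x w - c‖ ^ 2
      + 2 * |‖naive x 0 - c‖ ^ 2 - naiveRiskHat x|
      + 2 * ∑ k, w k * |inner ℝ (naive x 0 - c) (deviation x c k)|
      + 16 * √u * penaltyHat x w
      + 16 * √u * √(sampleVar (fun i => x 0 i - naive x 0) (naive x 0 - c) / N 0)
      + noiseExcess u η (naive x 0 - c) (fun i => x 0 i - naive x 0) (deviation x c) := by
  have hLv := norm_aggregate_sub_sq x c hv.1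
  have hLw := norm_aggregate_sub_sq x c hw
  have hcrit := hv.2 w hw
  rw [criterion, criterion] at hcrit
  have hpv := le_penaltyHat x c hv.1
  have hpv0 := penaltyHat_nonneg x hv.1
  have hagg := aggregate_sub_eq x c hv.1
  have hH0 := noiseExcess_nonneg u η (naive x 0 - c) (fun i => x 0 i - naive x 0)
    (deviation x c) (k := 0) (by simp [deviation])
  have hH := le_noiseExcess u η (naive x 0 - c) (fun i => x 0 i - naive x 0) (deviation x c) hv.1
  have hwZ : -∑ k, w k * |inner ℝ (naive x 0 - c) (deviation x c k)|
      ≤ inner ℝ (naive x 0 - c) (∑ k, w k • deviation x c k) := by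
    rw [inner_sum, ← Finset.sum_neg_distrib]
    refine Finset.sum_le_sum fun k _ => ?_
    rw [inner_smul_right, ← mul_neg]
    exact mul_le_mul_of_nonneg_left (neg_abs_le _) (hw.1 k)
  set e := naive x 0 - c with he
  set Zv := ∑ k, v k • deviation x c k with hZv
  set T := ‖e‖ ^ 2 - naiveRiskHat x with hT
  set r := √(sampleVar (fun i => x 0 i - naive x 0) e / N 0) with hr
  have hr0 : 0 ≤ r := Real.sqrt_nonneg _
  have hu0 : 0 ≤ √u := Real.sqrt_nonneg _
  have hTT : (2 * v 0 - 1) * T - (2 * w 0 - 1) * T ≤ 2 * |T| := by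
    have hv1 : v 0 ≤ 1 := hv.1.2 ▸ Finset.single_le_sum (fun k _ => hv.1.1 k) (Finset.mem_univ 0)
    have hw1 : w 0 ≤ 1 := hw.2 ▸ Finset.single_le_sum (fun k _ => hw.1 k) (Finset.mem_univ 0)
    have hv0 := hv.1.1 0
    have hw0 := hw.1 0
    have h1 : |v 0 - w 0| ≤ 1 := by rw [abs_le]; constructor <;> linarith
    have h2 : (v 0 - w 0) * T ≤ |v 0 - w 0| * |T| := (le_abs_self _).trans (abs_mul _ _).le
    have h3 := mul_le_mul_of_nonneg_right h1 (abs_nonneg T)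
    linarith
  have hmain : 2 * inner ℝ e Zv - 16 * √u * penaltyHat x v
      ≤ 16 * √u * r + noiseExcess u η e (fun i => x 0 i - naive x 0) (deviation x c)
        + η * ‖aggregate x v - c‖ ^ 2 := by
    have hηL : 0 ≤ η * ‖aggregate x v - c‖ ^ 2 := by positivity
    have hur : 0 ≤ 16 * √u * r := by positivity
    have hup : 0 ≤ 16 * √u * penaltyHat x v := by positivity
    obtain hneg | hpos := le_total (inner ℝ e Zv) 0
    · linarith
    · -- a favourable noise direction makes `‖Zv‖` smaller than the loss
      have hZ : ‖Zv‖ ^ 2 ≤ ‖aggregate x v - c‖ ^ 2 := by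
        rw [hagg, norm_add_sq_real, inner_smul_left, RCLike.conj_to_real]
        have := mul_nonneg (hv.1.1 0) hpos
        nlinarith [sq_nonneg ‖v 0 • e‖]
      have h1 := mul_le_mul_of_nonneg_left hZ hη
      have h2 := mul_le_mul_of_nonneg_left hpv (by positivity : 0 ≤ 16 * √u)
      linarith
  linarith

end Deterministic

/-! ### Expectations in the Gaussian model -/

section Model

variable {d B : ℕ} {N : Fin B → ℕ} [NeZero B] {Ω : Type*} [MeasurableSpace Ω] {P : Measure Ω}
  [IsProbabilityMeasure P]

/-- The Gaussian model: nonempty independent samples, the `k`-th one with law `N(μ k, S k)`, and at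
least two observations of the target task. -/
structure IsGaussianModel (P : Measure Ω)
    (X : (k : Fin B) → Fin (N k) → Ω → EuclideanSpace ℝ (Fin d))
    (μ : Fin B → EuclideanSpace ℝ (Fin d)) (S : Fin B → Matrix (Fin d) (Fin d) ℝ) : Prop where
  pos : ∀ k, 1 ≤ N k
  two_le : 2 ≤ N 0
  sample : ∀ k, IsGaussianSample P (X k) (μ k) (S k)
  indep : iIndepFun (fun p : (k : Fin B) × Fin (N k) => X p.1 p.2) P

/-- The data set observed at a point of the probability space. -/
def dataAt (X : (k : Fin B) → Fin (N k) → Ω → EuclideanSpace ℝ (Fin d)) (a : Ω) : Dataset d B N :=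
  fun k i => X k i a

variable {X : (k : Fin B) → Fin (N k) → Ω → EuclideanSpace ℝ (Fin d)}
  {μ : Fin B → EuclideanSpace ℝ (Fin d)} {S : Fin B → Matrix (Fin d) (Fin d) ℝ}

lemma naive_dataAt (k : Fin B) : (fun a => naive (dataAt X a) k) = sampleMean (X k) := rfl

namespace IsGaussianModel

variable (h : IsGaussianModel P X μ S)
include h

lemma aemeasurable_naive (k : Fin B) : AEMeasurable (fun a => naive (dataAt X a) k) P :=
  (h.sample k).aemeasurable_sampleMean

lemma memLp_naive (k : Fin B) : MemLp (fun a => naive (dataAt X a) k) 2 P :=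
  (h.sample k).hasGaussianLaw_sampleMean.memLp_two

lemma aemeasurable_deviation (c : EuclideanSpace ℝ (Fin d)) :
    AEMeasurable (fun a => deviation (dataAt X a) c) P := by
  refine aemeasurable_pi_lambda _ fun k => ?_
  unfold deviation
  split_ifs
  · fun_prop
  · exact (h.aemeasurable_naive k).sub_const c

/-- The target sample is independent of the deviations of the other tasks. -/
lemma indepFun_target_deviation (c : EuclideanSpace ℝ (Fin d)) :
    IndepFun (fun a i => X 0 i a) (fun a => deviation (dataAt X a) c) P := by
  classical
  have hm : ∀ p : (k : Fin B) × Fin (N k), AEMeasurable (X p.1 p.2) P := fun p =>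
    (h.sample p.1).aemeasurable p.2
  set s : Finset ((k : Fin B) × Fin (N k)) := Finset.univ.filter fun p => p.1 = 0 with hs
  set t : Finset ((k : Fin B) × Fin (N k)) := Finset.univ.filter fun p => ¬ p.1 = 0 with ht
  have hst : Disjoint s t := Finset.disjoint_filter_filter_not _ _ _
  have hind := h.indep.indepFun_finset₀ s t hst hm
  set φ : (s → EuclideanSpace ℝ (Fin d)) → (Fin (N 0) → EuclideanSpace ℝ (Fin d)) :=
    fun x i => x ⟨⟨0, i⟩, by simp [hs]⟩ with hφ
  set ψ : (t → EuclideanSpace ℝ (Fin d)) → (Fin B → EuclideanSpace ℝ (Fin d)) :=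
    fun x k => if hk : k = 0 then 0 else
      (1 / (N k : ℝ)) • ∑ i, x ⟨⟨k, i⟩, by simp [ht, hk]⟩ - c with hψ
  have hφm : Measurable φ := by fun_prop
  have hψm : Measurable ψ := by
    refine measurable_pi_lambda _ fun k => ?_
    by_cases hk : k = 0
    · simp [hψ, hk]
    · simp only [hψ, hk, dite_false]
      fun_prop
  have := hind.comp hφm hψm
  have hψe : (fun a => deviation (dataAt X a) c)
      = ψ ∘ fun a (p : t) => X p.1.1 p.1.2 a := by
    funext a k
    by_cases hk : k = 0
    · simp [hψ, hk, deviation]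
    · simp [hψ, hk, deviation, naive, dataAt]
  rw [hψe]
  exact this

lemma indepFun_mean_centred_deviation (c : EuclideanSpace ℝ (Fin d)) :
    IndepFun (fun a => (naive (dataAt X a) 0 - c, centred (X 0) a))
      (fun a => deviation (dataAt X a) c) P := by
  have hm : Measurable fun x : Fin (N 0) → EuclideanSpace ℝ (Fin d) =>
      ((1 / (N 0 : ℝ)) • ∑ i, x i - c, fun i => x i - (1 / (N 0 : ℝ)) • ∑ i, x i) := by
    fun_prop
  exact (h.indepFun_target_deviation c).comp hm measurable_id

lemma integral_inner_deviation_sq {k : Fin B} (hk : k ≠ 0) (c v : EuclideanSpace ℝ (Fin d)) :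
    Integrable (fun a => inner ℝ v (deviation (dataAt X a) c k) ^ 2) P ∧
    ∫ a, inner ℝ v (deviation (dataAt X a) c k) ^ 2 ∂P
      = inner ℝ v (μ k - c) ^ 2 + quad ((1 / (N k : ℝ)) • S k) v := by
  obtain ⟨h1, h2, h3⟩ := (h.sample k).moments_inner_sampleMean (h.pos k) v
  have e : ∀ a, inner ℝ v (deviation (dataAt X a) c k) ^ 2
      = inner ℝ v (sampleMean (X k) a - μ k) ^ 2
        + (2 * inner ℝ v (μ k - c)) * inner ℝ v (sampleMean (X k) a - μ k)
        + inner ℝ v (μ k - c) ^ 2 := by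
    intro a
    have : deviation (dataAt X a) c k = (sampleMean (X k) a - μ k) + (μ k - c) := by
      rw [deviation, if_neg hk, ← naive_dataAt]; abel
    rw [this, inner_add_right]; ring
  simp_rw [e]
  have hi1 := h1.integrable_sq
  have hi2 := (h1.integrable (by norm_num)).const_mul (2 * inner ℝ v (μ k - c))
  have hi12 : Integrable (fun a => inner ℝ v (sampleMean (X k) a - μ k) ^ 2
        + (2 * inner ℝ v (μ k - c)) * inner ℝ v (sampleMean (X k) a - μ k)) P := hi1.add hi2
  refine ⟨hi12.add (integrable_const _), ?_⟩
  rw [integral_add hi12 (integrable_const _), integral_add hi1 hi2, integral_const_mul, h2, h3,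
    quad_smul_left]
  simp
  ring

lemma integral_quad_deviation {k : Fin B} (hk : k ≠ 0) :
    Integrable (fun a => quad (S 0) (deviation (dataAt X a) (μ 0) k)) P ∧
    ∫ a, quad (S 0) (deviation (dataAt X a) (μ 0) k) ∂P = q N μ S k := by
  have := integral_quad (h.sample 0).posSemidef
    (fun v => (h.integral_inner_deviation_sq hk (μ 0) v).1)
    (fun v => (h.integral_inner_deviation_sq hk (μ 0) v).2)
  refine ⟨this.1, this.2.trans ?_⟩
  rw [q, quad, Matrix.mul_smul, Matrix.trace_smul, smul_eq_mul]
  ring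

lemma q_nonneg {k : Fin B} (hk : k ≠ 0) : 0 ≤ q N μ S k := by
  rw [← (h.integral_quad_deviation hk).2]
  exact integral_nonneg fun a => quad_nonneg (h.sample 0).posSemidef _

/-- The risk of the naive estimator is `Tr S₀ / N₀`. -/
lemma naiveRisk_eq : naiveRisk P X (μ 0) = (S 0).trace / N 0 := by
  have := integral_quad (P := P) (S := (1 : Matrix (Fin d) (Fin d) ℝ)) Matrix.PosSemidef.one
    (W := fun a => sampleMean (X 0) a - μ 0) (Δ := 0) (R := (1 / (N 0 : ℝ)) • S 0)
    (fun v => ((h.sample 0).moments_inner_sampleMean (h.pos 0) v).1.integrable_sq)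
    (fun v => by
      rw [((h.sample 0).moments_inner_sampleMean (h.pos 0) v).2.2, quad_smul_left]
      simp; ring)
  have e : ∀ x : EuclideanSpace ℝ (Fin d), quad (1 : Matrix (Fin d) (Fin d) ℝ) x = ‖x‖ ^ 2 := by
    intro x
    rw [quad, Matrix.one_mulVec, EuclideanSpace.real_norm_sq_eq, dotProduct]
    exact Finset.sum_congr rfl fun i _ => by ring
  simp_rw [e] at this
  refine this.2.trans ?_
  simp [Matrix.trace_smul]
  ring

lemma integral_abs_inner_deviation_le {k : Fin B} (hk : k ≠ 0) :
    Integrable (fun a => |inner ℝ (naive (dataAt X a) 0 - μ 0)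
      (deviation (dataAt X a) (μ 0) k)|) P ∧
    ∫ a, |inner ℝ (naive (dataAt X a) 0 - μ 0) (deviation (dataAt X a) (μ 0) k)| ∂P
      ≤ √(q N μ S k / N 0) := by
  have hdm := h.aemeasurable_deviation (μ 0)
  have hnm := h.aemeasurable_naive 0
  have hdk : AEMeasurable (fun a => deviation (dataAt X a) (μ 0) k) P :=
    (measurable_pi_apply k).comp_aemeasurable hdm
  have hind : IndepFun (fun a => deviation (dataAt X a) (μ 0) k)
      (fun a => naive (dataAt X a) 0 - μ 0) P :=
    ((h.indepFun_mean_centred_deviation (μ 0)).comp measurable_fst (measurable_pi_apply k)).symm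
  have hmom := (h.sample 0).moments_inner_sampleMean (h.pos 0)
  have hq := h.integral_quad_deviation hk
  have hint := integral_indep_of_nonneg hdk (hnm.sub_const (μ 0)) hind
    (f := fun v x => inner ℝ v x ^ 2) (g := fun v => quad (S 0) v / N 0) (by fun_prop)
    (fun _ _ => sq_nonneg _) (fun v => (hmom v).1.integrable_sq) (fun v => (hmom v).2.2)
    (hq.1.div_const _)
  have hmem : MemLp (fun a => inner ℝ (naive (dataAt X a) 0 - μ 0)
      (deviation (dataAt X a) (μ 0) k)) 2 P := by
    refine (memLp_two_iff_integrable_sq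
      (AEMeasurable.aestronglyMeasurable (by fun_prop))).2 ?_
    refine hint.1.congr (Filter.Eventually.of_forall fun a => ?_)
    dsimp only
    rw [real_inner_comm]
  refine ⟨(hmem.integrable (by norm_num)).abs, (integral_abs_le_sqrt hmem).trans (le_of_eq ?_)⟩
  congr 1
  have e : ∀ a, inner ℝ (naive (dataAt X a) 0 - μ 0) (deviation (dataAt X a) (μ 0) k) ^ 2
      = inner ℝ (deviation (dataAt X a) (μ 0) k) (naive (dataAt X a) 0 - μ 0) ^ 2 := fun a => by
    rw [real_inner_comm]
  simp_rw [e]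
  rw [hint.2, integral_div, hq.2]

/-- The mean empirical variance of the target sample in the random direction from a fixed
deviation `v` to the error of the target mean. -/
lemma integral_sampleVar_sub (v : EuclideanSpace ℝ (Fin d)) :
    Integrable (fun a => sampleVar (centred (X 0) a) (naive (dataAt X a) 0 - μ 0 - v)) P ∧
    ∫ a, sampleVar (centred (X 0) a) (naive (dataAt X a) 0 - μ 0 - v) ∂P
      = quad (S 0) v + (S 0 * S 0).trace / N 0 := by
  have hs := h.sample 0
  have hnm := h.aemeasurable_naive 0
  have hmom := hs.moments_inner_sampleMean (h.pos 0)
  have hq := integral_quad (P := P) hs.posSemidef (W := fun a => naive (dataAt X a) 0 - μ 0 - v)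
    (Δ := -v) (R := (1 / (N 0 : ℝ)) • S 0) (fun t => by
      simp_rw [inner_sub_right (𝕜 := ℝ) t _ v]
      exact ((hmom t).1.sub (memLp_const _)).integrable_sq) (fun t => by
      obtain ⟨h1, h2, h3⟩ := hmom t
      have e : ∀ a, inner ℝ t (naive (dataAt X a) 0 - μ 0 - v) ^ 2
          = inner ℝ t (sampleMean (X 0) a - μ 0) ^ 2
            - (2 * inner ℝ t v) * inner ℝ t (sampleMean (X 0) a - μ 0) + inner ℝ t v ^ 2 := by
        intro a
        rw [inner_sub_right, ← naive_dataAt]; ring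
      have hi2 := (h1.integrable (by norm_num)).const_mul (2 * inner ℝ t v)
      simp_rw [e]
      rw [integral_add (f := fun a => inner ℝ t (sampleMean (X 0) a - μ 0) ^ 2
            - (2 * inner ℝ t v) * inner ℝ t (sampleMean (X 0) a - μ 0))
          (h1.integrable_sq.sub hi2) (integrable_const _), integral_sub h1.integrable_sq hi2,
        integral_const_mul, h2, h3, quad_smul_left]
      simp
      ring)
  have hneg : quad (S 0) (-v) = quad (S 0) v := by
    rw [← neg_one_smul ℝ v, quad_smul]; norm_num
  have htr : (S 0 * ((1 / (N 0 : ℝ)) • S 0)).trace = (S 0 * S 0).trace / N 0 := by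
    rw [Matrix.mul_smul, Matrix.trace_smul, smul_eq_mul]; ring
  rw [hneg, htr] at hq
  have hvm : Measurable fun p : EuclideanSpace ℝ (Fin d) × (Fin (N 0) → EuclideanSpace ℝ (Fin d)) =>
      sampleVar p.2 (p.1 - v) := by
    unfold sampleVar; fun_prop
  have := integral_indep_of_nonneg (hnm.sub_const (μ 0)) hs.aemeasurable_centred
    (hs.indepFun_sampleMean_centred (h.pos 0)) (f := fun x Y => sampleVar Y (x - v))
    (g := fun x => quad (S 0) (x - v)) hvm (fun _ _ => sampleVar_nonneg (h.pos 0) _ _)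
    (fun x => (hs.integral_sampleVar h.two_le _).1) (fun x => (hs.integral_sampleVar h.two_le _).2)
    hq.1
  exact ⟨this.1, this.2.trans hq.2⟩

omit h in
lemma integral_sqrt_le {f : Ω → ℝ} (hf0 : ∀ a, 0 ≤ f a) (hf : Integrable f P) :
    Integrable (fun a => √(f a)) P ∧ ∫ a, √(f a) ∂P ≤ √(∫ a, f a ∂P) := by
  have hm : MemLp (fun a => √(f a)) 2 P := by
    refine (memLp_two_iff_integrable_sq ?_).2 ?_
    · exact (hf.aemeasurable.sqrt).aestronglyMeasurable
    · exact hf.congr (Filter.Eventually.of_forall fun a => (Real.sq_sqrt (hf0 a)).symm)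
  refine ⟨hm.integrable (by norm_num), ?_⟩
  have := integral_abs_le_sqrt hm
  simp_rw [abs_of_nonneg (Real.sqrt_nonneg _), Real.sq_sqrt (hf0 _)] at this
  exact this

lemma integral_sqrt_sampleVar_error_le :
    Integrable (fun a => √(sampleVar (centred (X 0) a) (naive (dataAt X a) 0 - μ 0) / N 0)) P ∧
    ∫ a, √(sampleVar (centred (X 0) a) (naive (dataAt X a) 0 - μ 0) / N 0) ∂P
      ≤ √((S 0 * S 0).trace) / N 0 := by
  have h1 := h.integral_sampleVar_sub 0
  simp only [sub_zero] at h1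
  have hN : (0 : ℝ) < N 0 := by exact_mod_cast h.pos 0
  obtain ⟨h2, h3⟩ := integral_sqrt_le (fun a => div_nonneg (sampleVar_nonneg (h.pos 0) _ _) hN.le)
    (h1.1.div_const (N 0 : ℝ))
  refine ⟨h2, h3.trans (le_of_eq ?_)⟩
  rw [integral_div, h1.2]
  have : (quad (S 0) 0 + (S 0 * S 0).trace / N 0) / (N 0 : ℝ) = (S 0 * S 0).trace / N 0 ^ 2 := by
    simp [quad]; field_simp
  rw [this, Real.sqrt_div' _ (by positivity), Real.sqrt_sq hN.le]

lemma integral_sqrt_qHat_le {k : Fin B} (hk : k ≠ 0) :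
    Integrable (fun a => √(qHat (dataAt X a) k / N 0)) P ∧
    ∫ a, √(qHat (dataAt X a) k / N 0) ∂P
      ≤ √(q N μ S k / N 0) + √((S 0 * S 0).trace) / N 0 := by
  have hN : (0 : ℝ) < N 0 := by exact_mod_cast h.pos 0
  have hdm := h.aemeasurable_deviation (μ 0)
  have hnm := h.aemeasurable_naive 0
  have hs := h.sample 0
  have hdk : AEMeasurable (fun a => deviation (dataAt X a) (μ 0) k) P :=
    (measurable_pi_apply k).comp_aemeasurable hdm
  have hind : IndepFun (fun a => deviation (dataAt X a) (μ 0) k)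
      (fun a => (naive (dataAt X a) 0 - μ 0, centred (X 0) a)) P :=
    ((h.indepFun_mean_centred_deviation (μ 0)).comp measurable_id (measurable_pi_apply k)).symm
  have hq := h.integral_quad_deviation hk
  have hvm : Measurable fun p : EuclideanSpace ℝ (Fin d) ×
      (EuclideanSpace ℝ (Fin d) × (Fin (N 0) → EuclideanSpace ℝ (Fin d))) =>
      sampleVar p.2.2 (p.2.1 - p.1) := by
    unfold sampleVar; fun_prop
  have h1 := integral_indep_of_nonneg hdk ((hnm.sub_const (μ 0)).prodMk hs.aemeasurable_centred)
    hind (f := fun v p => sampleVar p.2 (p.1 - v))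
    (g := fun v => quad (S 0) v + (S 0 * S 0).trace / N 0) hvm
    (fun _ _ => sampleVar_nonneg (h.pos 0) _ _)
    (fun v => (h.integral_sampleVar_sub v).1) (fun v => (h.integral_sampleVar_sub v).2)
    (hq.1.add (integrable_const _))
  rw [integral_add hq.1 (integrable_const _), hq.2] at h1
  have e : ∀ a, qHat (dataAt X a) k = sampleVar (centred (X 0) a)
      (naive (dataAt X a) 0 - μ 0 - deviation (dataAt X a) (μ 0) k) := fun a =>
    qHat_eq_sampleVar _ _ hk
  simp_rw [e]
  obtain ⟨h2, h3⟩ := integral_sqrt_le (fun a => div_nonneg (sampleVar_nonneg (h.pos 0) _ _) hN.le)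
    (h1.1.div_const (N 0 : ℝ))
  refine ⟨h2, h3.trans ?_⟩
  rw [integral_div, h1.2]
  have hτ := trace_mul_self_nonneg hs.posSemidef
  have hq0 := h.q_nonneg hk
  simp only [integral_const, probReal_univ, one_smul]
  rw [add_div]
  have hr : √((S 0 * S 0).trace / N 0 / N 0) = √((S 0 * S 0).trace) / N 0 := by
    rw [div_div, Real.sqrt_div' _ (by positivity), Real.sqrt_mul_self hN.le]
  rw [← hr, Real.sqrt_le_iff]
  have ha : 0 ≤ q N μ S k / N 0 := by positivity
  have hb : 0 ≤ (S 0 * S 0).trace / N 0 / N 0 := by positivity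
  refine ⟨by positivity, ?_⟩
  rw [add_sq, Real.sq_sqrt ha, Real.sq_sqrt hb]
  have := mul_nonneg (Real.sqrt_nonneg (q N μ S k / N 0))
    (Real.sqrt_nonneg ((S 0 * S 0).trace / N 0 / N 0))
  linarith

/-- The mean noise excess in the Gaussian model, with `η` the failure probability given by the
union bound. -/
lemma integral_noiseExcess_le {u : ℝ} (hu : 0 ≤ u) (huN : u ≤ ((N 0 : ℝ) - 1) / 2)
    (hB : B * Real.exp (-u) ≤ 1 / 2) :
    Integrable (fun a => noiseExcess u (B * Real.exp (-u)) (naive (dataAt X a) 0 - μ 0)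
      (centred (X 0) a) (deviation (dataAt X a) (μ 0))) P ∧
    ∫ a, noiseExcess u (B * Real.exp (-u)) (naive (dataAt X a) 0 - μ 0)
      (centred (X 0) a) (deviation (dataAt X a) (μ 0)) ∂P
      ≤ 22 * (√((S 0 * S 0).trace) / N 0) := by
  have hN : (0 : ℝ) < N 0 := by exact_mod_cast h.pos 0
  have hB0 : (0 : ℝ) < B := by exact_mod_cast Nat.pos_of_ne_zero (NeZero.ne B)
  have hs := h.sample 0
  set η := B * Real.exp (-u) with hη
  have hη0 : 0 < η := by positivity
  have hem : AEMeasurable (fun a => naive (dataAt X a) 0 - μ 0) P :=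
    (h.aemeasurable_naive 0).sub_const _
  have hYm := hs.aemeasurable_centred
  have hdm := h.aemeasurable_deviation (μ 0)
  set W : Ω → (EuclideanSpace ℝ (Fin d) × (Fin (N 0) → EuclideanSpace ℝ (Fin d))) ×
    (Fin B → EuclideanSpace ℝ (Fin d)) := fun a =>
      ((naive (dataAt X a) 0 - μ 0, centred (X 0) a), deviation (dataAt X a) (μ 0)) with hW
  have hWm : AEMeasurable W P := (hem.prodMk hYm).prodMk hdm
  have hc := continuous_noiseExcess (E := EuclideanSpace ℝ (Fin d)) (ι := Fin B) (n := N 0) u η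
  have hlaw : P.map W = (((stdGaussian (EuclideanSpace ℝ (Fin d))).map
      fun x => (√(N 0 : ℝ))⁻¹ • sqrtMap (S 0) x).prod (P.map (centred (X 0)))).prod
        (P.map fun a => deviation (dataAt X a) (μ 0)) := by
    rw [hW, (h.indepFun_mean_centred_deviation (μ 0)).map_prod_eq_prod_map_map (hem.prodMk hYm) hdm]
    congr 1
    rw [← (hs.sampleMean_sub_hasLaw (h.pos 0)).map_eq]
    exact (hs.indepFun_sampleMean_centred (h.pos 0)).map_prod_eq_prod_map_map hem hYm
  have hf0 : ∀ a, 0 ≤ noiseExcess u η (naive (dataAt X a) 0 - μ 0)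
      (centred (X 0) a) (deviation (dataAt X a) (μ 0)) := fun a =>
    noiseExcess_nonneg u η _ _ _ (k := 0) (by simp [deviation])
  have hmeas : AEStronglyMeasurable (fun a => noiseExcess u η (naive (dataAt X a) 0 - μ 0)
      (centred (X 0) a) (deviation (dataAt X a) (μ 0))) P :=
    (hc.measurable.comp_aemeasurable hWm).aestronglyMeasurable
  have hpY : IsProbabilityMeasure (P.map (centred (X 0))) := Measure.isProbabilityMeasure_map hYm
  have hpV : IsProbabilityMeasure (P.map fun a => deviation (dataAt X a) (μ 0)) :=
    Measure.isProbabilityMeasure_map hdm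
  have hle : ∫⁻ a, ENNReal.ofReal (noiseExcess u η (naive (dataAt X a) 0 - μ 0)
      (centred (X 0) a) (deviation (dataAt X a) (μ 0))) ∂P
      ≤ ENNReal.ofReal (22 * (√((S 0 * S 0).trace) / N 0)) := by
    have e : ∫⁻ a, ENNReal.ofReal (noiseExcess u η (naive (dataAt X a) 0 - μ 0)
        (centred (X 0) a) (deviation (dataAt X a) (μ 0))) ∂P
        = ∫⁻ z, ENNReal.ofReal (noiseExcess u η z.1.1 z.1.2 z.2) ∂(P.map W) :=
      (lintegral_map' hc.measurable.ennreal_ofReal.aemeasurable hWm).symm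
    rw [e, hlaw]
    refine (lintegral_noiseExcess_prod_le (h.pos 0) (sqrtMap (S 0))
      (Real.sqrt_nonneg (S 0 * S 0).trace) (fun z => ?_) hu hη0 (by simpa using hB)
      (P.map (centred (X 0))) (P.map fun a => deviation (dataAt X a) (μ 0)) (fun v => ?_)).trans ?_
    · rw [norm_adjoint_sqrtMap_sq hs.posSemidef]
      exact quad_le hs.posSemidef z
    · rw [norm_adjoint_sqrtMap_sq hs.posSemidef, map_measureReal_apply_of_aemeasurable hYm]
      · exact hs.measure_sampleVar_lt_le h.two_le huN v
      · refine (isOpen_lt ?_ continuous_const).measurableSet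
        unfold sampleVar; fun_prop
    · refine ENNReal.ofReal_le_ofReal (le_of_eq ?_)
      rw [Fintype.card_fin, ← hη]
      field_simp
  have hint : Integrable (fun a => noiseExcess u η (naive (dataAt X a) 0 - μ 0)
      (centred (X 0) a) (deviation (dataAt X a) (μ 0))) P := by
    refine ⟨hmeas, ?_⟩
    rw [hasFiniteIntegral_iff_ofReal (Filter.Eventually.of_forall hf0)]
    exact hle.trans_lt ENNReal.ofReal_lt_top
  refine ⟨hint, ?_⟩
  rw [← ofReal_integral_eq_lintegral_ofReal hint (Filter.Eventually.of_forall hf0)] at hle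
  exact (ENNReal.ofReal_le_ofReal_iff (by positivity)).1 hle

end IsGaussianModel

end Model

/-! ### The oracle inequality in expectation -/

section Oracle

variable {d B : ℕ} {N : Fin B → ℕ} [NeZero B] {Ω : Type*} [MeasurableSpace Ω] {P : Measure Ω}
  [IsProbabilityMeasure P] {X : (k : Fin B) → Fin (N k) → Ω → EuclideanSpace ℝ (Fin d)}
  {μ : Fin B → EuclideanSpace ℝ (Fin d)} {S : Fin B → Matrix (Fin d) (Fin d) ℝ}

namespace IsGaussianModel

variable (h : IsGaussianModel P X μ S)
include h

lemma integrable_aggregate_sub_sq (w : Fin B → ℝ) (c : EuclideanSpace ℝ (Fin d)) :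
    Integrable (fun a => ‖aggregate (dataAt X a) w - c‖ ^ 2) P := by
  have : MemLp (fun a => aggregate (dataAt X a) w - c) 2 P :=
    (memLp_finsetSum _ fun k _ => (h.memLp_naive k).const_smul (w k)).sub (memLp_const c)
  exact this.norm.integrable_sq

lemma integral_penaltyHat_le {w : Fin B → ℝ} (hw : w ∈ stdSimplex ℝ (Fin B)) :
    Integrable (fun a => penaltyHat (dataAt X a) w) P ∧
    ∫ a, penaltyHat (dataAt X a) w ∂P ≤ penalty N μ S w + √((S 0 * S 0).trace) / N 0 := by
  have hi : ∀ k ∈ Finset.univ.erase (0 : Fin B),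
      Integrable (fun a => w k * √(qHat (dataAt X a) k / N 0)) P := fun k hk =>
    (h.integral_sqrt_qHat_le (Finset.ne_of_mem_erase hk)).1.const_mul _
  refine ⟨integrable_finsetSum _ hi, ?_⟩
  unfold penaltyHat
  rw [integral_finsetSum _ hi]
  have hle : ∀ k ∈ Finset.univ.erase (0 : Fin B), ∫ a, w k * √(qHat (dataAt X a) k / N 0) ∂P
      ≤ w k * √(q N μ S k / N 0) + w k * (√((S 0 * S 0).trace) / N 0) := fun k hk => by
    rw [integral_const_mul, ← mul_add]
    exact mul_le_mul_of_nonneg_left (h.integral_sqrt_qHat_le (Finset.ne_of_mem_erase hk)).2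
      (hw.1 k)
  refine (Finset.sum_le_sum hle).trans ?_
  rw [Finset.sum_add_distrib, ← Finset.sum_mul, penalty]
  have hs : ∑ k ∈ Finset.univ.erase 0, w k ≤ 1 := by
    rw [← hw.2]
    exact Finset.sum_le_sum_of_subset_of_nonneg (Finset.erase_subset _ _) fun k _ _ => hw.1 k
  have : 0 ≤ √((S 0 * S 0).trace) / N 0 := by positivity
  linarith [mul_le_mul_of_nonneg_right hs this]

lemma integral_sum_abs_inner_deviation_le {w : Fin B → ℝ} (hw : w ∈ stdSimplex ℝ (Fin B)) :
    Integrable (fun a => ∑ k, w k * |inner ℝ (naive (dataAt X a) 0 - μ 0)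
      (deviation (dataAt X a) (μ 0) k)|) P ∧
    ∫ a, ∑ k, w k * |inner ℝ (naive (dataAt X a) 0 - μ 0) (deviation (dataAt X a) (μ 0) k)| ∂P
      ≤ penalty N μ S w := by
  have e : ∀ a, ∑ k, w k * |inner ℝ (naive (dataAt X a) 0 - μ 0)
        (deviation (dataAt X a) (μ 0) k)|
      = ∑ k ∈ Finset.univ.erase 0, w k * |inner ℝ (naive (dataAt X a) 0 - μ 0)
        (deviation (dataAt X a) (μ 0) k)| := fun a => by
    rw [← Finset.add_sum_erase _ _ (Finset.mem_univ 0)]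
    simp [deviation]
  simp_rw [e]
  have hi : ∀ k ∈ Finset.univ.erase (0 : Fin B), Integrable (fun a =>
      w k * |inner ℝ (naive (dataAt X a) 0 - μ 0) (deviation (dataAt X a) (μ 0) k)|) P :=
    fun k hk => (h.integral_abs_inner_deviation_le (Finset.ne_of_mem_erase hk)).1.const_mul _
  refine ⟨integrable_finsetSum _ hi, ?_⟩
  rw [integral_finsetSum _ hi]
  refine Finset.sum_le_sum fun k hk => ?_
  rw [integral_const_mul]
  exact mul_le_mul_of_nonneg_left (h.integral_abs_inner_deviation_le
    (Finset.ne_of_mem_erase hk)).2 (hw.1 k)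

/-- The oracle inequality against fixed weights `w`. The first conclusion holds because the loss is
dominated by an integrable function, whatever the dependence of `wHat` on the data. -/
lemma aggRisk_le {u : ℝ} (hu : Real.log (17 * (B : ℝ)) ≤ u) (huN : u ≤ ((N 0 : ℝ) - 1) / 2)
    {wHat : Ω → Fin B → ℝ} (hwm : AEMeasurable wHat P)
    (hwHat : ∀ᵐ a ∂P, IsQAggregationWeight u (dataAt X a) (wHat a))
    {w : Fin B → ℝ} (hw : w ∈ stdSimplex ℝ (Fin B)) :
    Integrable (fun a => ‖aggregate (dataAt X a) (wHat a) - μ 0‖ ^ 2) P ∧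
    aggRisk P X (μ 0) wHat ≤ aggRisk P X (μ 0) (fun _ => w) * (1 + 2 * B * Real.exp (-u))
      + 36 * penalty N μ S w * √u + 116 * (u * (√((S 0 * S 0).trace) / N 0)) := by
  have hB : (1 : ℝ) ≤ B := by exact_mod_cast Nat.one_le_iff_ne_zero.2 (NeZero.ne B)
  have hu1 : 1 ≤ u := by
    refine le_trans ?_ hu
    rw [Real.le_log_iff_exp_le (by positivity)]
    linarith [Real.exp_one_lt_d9]
  have hηs : B * Real.exp (-u) ≤ 1 / 17 := by
    have h1 : 17 * (B : ℝ) ≤ Real.exp u := by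
      rwa [← Real.log_le_iff_le_exp (by positivity)]
    rw [Real.exp_neg, ← div_eq_mul_inv, div_le_iff₀ (Real.exp_pos u)]
    linarith
  have hη0 : 0 < B * Real.exp (-u) := by positivity
  have hsu1 : 1 ≤ √u := Real.one_le_sqrt.2 hu1
  have hsu : √u ≤ u := by
    have := Real.sq_sqrt (zero_le_one.trans hu1)
    nlinarith
  obtain ⟨i1, b1⟩ := (h.sample 0).integral_abs_norm_sq_sub_le h.two_le
  obtain ⟨i2, b2⟩ := h.integral_sum_abs_inner_deviation_le hw
  obtain ⟨i3, b3⟩ := h.integral_penaltyHat_le hw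
  obtain ⟨i4, b4⟩ := h.integral_sqrt_sampleVar_error_le
  obtain ⟨i5, b5⟩ := h.integral_noiseExcess_le (zero_le_one.trans hu1) huN
    (hηs.trans (by norm_num))
  have i0 := h.integrable_aggregate_sub_sq w (μ 0)
  set η := B * Real.exp (-u) with hη
  set t := √((S 0 * S 0).trace) / N 0 with ht
  have ht0 : 0 ≤ t := by positivity
  have hp0 : 0 ≤ penalty N μ S w :=
    Finset.sum_nonneg fun k _ => mul_nonneg (hw.1 k) (Real.sqrt_nonneg _)
  have hη1 : 0 < 1 - η := by linarith
  have j1 := i0.add (i1.const_mul 2)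
  have j2 := j1.add (i2.const_mul 2)
  have j3 := j2.add (i3.const_mul (16 * √u))
  have j4 := j3.add (i4.const_mul (16 * √u))
  have j5 := j4.add i5
  have hle := hwHat.mono fun a ha => loss_le (dataAt X a) (μ 0) hη0.le ha hw
  have hmeas : AEStronglyMeasurable
      (fun a => (1 - η) * ‖aggregate (dataAt X a) (wHat a) - μ 0‖ ^ 2) P := by
    have hk : ∀ k, AEMeasurable (fun a => wHat a k) P := fun k =>
      (measurable_pi_apply k).comp_aemeasurable hwm
    have hn := h.aemeasurable_naive
    have : AEMeasurable (fun a => aggregate (dataAt X a) (wHat a)) P :=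
      Finset.aemeasurable_fun_sum _ fun k _ => (hk k).smul (hn k)
    exact (((this.sub_const (μ 0)).norm.pow_const 2).const_mul _).aestronglyMeasurable
  have hint : Integrable (fun a => (1 - η) * ‖aggregate (dataAt X a) (wHat a) - μ 0‖ ^ 2) P := by
    refine j5.mono' hmeas (hle.mono fun a ha => ?_)
    rw [Real.norm_of_nonneg (by positivity)]
    exact ha
  have hmain := integral_mono_ae hint j5 hle
  rw [integral_const_mul] at hmain
  have hint' : Integrable (fun a => ‖aggregate (dataAt X a) (wHat a) - μ 0‖ ^ 2) P := by
    refine (hint.const_mul (1 - η)⁻¹).congr (Filter.Eventually.of_forall fun a => ?_)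
    dsimp only
    field_simp
  refine ⟨hint', ?_⟩
  rw [integral_add' j4 i5, integral_add' j3 (i4.const_mul _), integral_add' j2 (i3.const_mul _),
    integral_add' j1 (i2.const_mul _), integral_add' i0 (i1.const_mul _), integral_const_mul,
    integral_const_mul, integral_const_mul, integral_const_mul] at hmain
  set R := aggRisk P X (μ 0) wHat with hR
  set Rw := aggRisk P X (μ 0) fun _ => w with hRw
  have hRw0 : 0 ≤ Rw := integral_nonneg fun _ => sq_nonneg _
  have hu0 : 0 ≤ √u := Real.sqrt_nonneg _
  have c3 := mul_le_mul_of_nonneg_left b3 (by positivity : 0 ≤ 16 * √u)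
  have c4 := mul_le_mul_of_nonneg_left b4 (by positivity : 0 ≤ 16 * √u)
  have c1 : ∫ a, |‖naive (dataAt X a) 0 - μ 0‖ ^ 2 - naiveRiskHat (dataAt X a)| ∂P ≤ 2 * t := b1
  have hstep : (1 - η) * R ≤ Rw + 18 * penalty N μ S w * √u + 58 * (u * t) := by
    have e1 : penalty N μ S w ≤ penalty N μ S w * √u := le_mul_of_one_le_right hp0 hsu1
    have e2 : √u * t ≤ u * t := mul_le_mul_of_nonneg_right hsu ht0
    have e3 : t ≤ u * t := le_mul_of_one_le_left ht0 hu1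
    have hmain' : (1 - η) * R ≤ Rw
      + 2 * ∫ a, |‖naive (dataAt X a) 0 - μ 0‖ ^ 2 - naiveRiskHat (dataAt X a)| ∂P
      + 2 * ∫ a, ∑ k, w k * |inner ℝ (naive (dataAt X a) 0 - μ 0)
          (deviation (dataAt X a) (μ 0) k)| ∂P
      + 16 * √u * ∫ a, penaltyHat (dataAt X a) w ∂P
      + 16 * √u * ∫ a, √(sampleVar (centred (X 0) a) (naive (dataAt X a) 0 - μ 0) / N 0) ∂P
      + ∫ a, noiseExcess u η (naive (dataAt X a) 0 - μ 0)
          (centred (X 0) a) (deviation (dataAt X a) (μ 0)) ∂P := hmain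
    linarith
  -- `1 ≤ (1 - η) * (1 + 2 * η)` because `η ≤ 1 / 2`
  have hinv : R ≤ (1 + 2 * η) * ((1 - η) * R) := by
    have hR0 : 0 ≤ R := integral_nonneg fun _ => sq_nonneg _
    have : 0 ≤ η * (1 - 2 * η) * R := by
      refine mul_nonneg (mul_nonneg hη0.le ?_) hR0
      linarith
    linarith
  have hpu : 0 ≤ penalty N μ S w * √u := by positivity
  have htu : 0 ≤ u * t := by positivity
  refine hinv.trans ((mul_le_mul_of_nonneg_left hstep (by positivity)).trans ?_)
  have f1 : η * (penalty N μ S w * √u) ≤ 1 / 2 * (penalty N μ S w * √u) :=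
    mul_le_mul_of_nonneg_right (by linarith) hpu
  have f2 : η * (u * t) ≤ 1 / 2 * (u * t) := mul_le_mul_of_nonneg_right (by linarith) htu
  have f3 : 2 * B * Real.exp (-u) = 2 * η := by rw [hη]; ring
  rw [f3]
  linarith

lemma continuous_aggRisk (c : EuclideanSpace ℝ (Fin d)) :
    Continuous fun w : Fin B → ℝ => aggRisk P X c fun _ => w := by
  have hM := h.memLp_naive
  have e : ∀ w : Fin B → ℝ, (aggRisk P X c fun _ => w)
      = ∑ k, ∑ l, w k * (w l * ∫ a, inner ℝ (naive (dataAt X a) k) (naive (dataAt X a) l) ∂P)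
        - 2 * ∑ k, w k * ∫ a, inner ℝ (naive (dataAt X a) k) c ∂P + ‖c‖ ^ 2 := by
    intro w
    have hkl : ∀ k l, Integrable
        (fun a => inner ℝ (naive (dataAt X a) k) (naive (dataAt X a) l)) P := fun k l =>
      ((hM k).norm.integrable_mul (hM l).norm).mono'
        ((hM k).aestronglyMeasurable.inner (hM l).aestronglyMeasurable)
        (Filter.Eventually.of_forall fun a => norm_inner_le_norm _ _)
    have hkc : ∀ k, Integrable (fun a => inner ℝ (naive (dataAt X a) k) c) P := fun k =>
      ((hM k).inner_const (𝕜 := ℝ) c).integrable (by norm_num)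
    have hp : ∀ a, ‖aggregate (dataAt X a) w - c‖ ^ 2
        = ∑ k, ∑ l, w k * (w l * inner ℝ (naive (dataAt X a) k) (naive (dataAt X a) l))
          - 2 * ∑ k, w k * inner ℝ (naive (dataAt X a) k) c + ‖c‖ ^ 2 := by
      intro a
      rw [norm_sub_sq_real, ← real_inner_self_eq_norm_sq, aggregate, sum_inner, sum_inner]
      simp_rw [inner_sum, inner_smul_left, inner_smul_right, RCLike.conj_to_real]
    have i1 : Integrable (fun a => ∑ k, ∑ l,
        w k * (w l * inner ℝ (naive (dataAt X a) k) (naive (dataAt X a) l))) P :=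
      integrable_finsetSum _ fun k _ => integrable_finsetSum _ fun l _ =>
        ((hkl k l).const_mul _).const_mul _
    have i2 : Integrable (fun a => 2 * ∑ k, w k * inner ℝ (naive (dataAt X a) k) c) P :=
      (integrable_finsetSum _ fun k _ => (hkc k).const_mul _).const_mul _
    have hR : (aggRisk P X c fun _ => w) = ∫ a, ‖aggregate (dataAt X a) w - c‖ ^ 2 ∂P := rfl
    rw [hR]
    simp_rw [hp]
    have i12 : Integrable (fun a =>
        (∑ k, ∑ l, w k * (w l * inner ℝ (naive (dataAt X a) k) (naive (dataAt X a) l)))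
        - 2 * ∑ k, w k * inner ℝ (naive (dataAt X a) k) c) P := i1.sub i2
    rw [integral_add i12 (integrable_const _), integral_sub i1 i2, integral_const_mul,
      integral_finsetSum _ fun k _ => (hkc k).const_mul _,
      integral_finsetSum _ fun k _ => integrable_finsetSum _ fun l _ =>
        ((hkl k l).const_mul _).const_mul _]
    have e1 : ∀ k, ∫ a, ∑ l, w k * (w l * inner ℝ (naive (dataAt X a) k) (naive (dataAt X a) l)) ∂P
        = ∑ l, w k * (w l * ∫ a, inner ℝ (naive (dataAt X a) k) (naive (dataAt X a) l) ∂P) :=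
      fun k => by
        rw [integral_finsetSum _ fun l _ => ((hkl k l).const_mul _).const_mul _]
        simp_rw [integral_const_mul]
    simp_rw [e1, integral_const_mul]
    simp
  simp_rw [e]
  fun_prop

lemma exists_isMinOn_oracleBound (C u : ℝ) : ∃ w ∈ stdSimplex ℝ (Fin B),
    IsMinOn (oracleBound P X μ S C u) (stdSimplex ℝ (Fin B)) w := by
  have hc : Continuous (oracleBound P X μ S C u) := by
    have := h.continuous_aggRisk (μ 0)
    have hp : Continuous (penalty N μ S) := by unfold penalty; fun_prop
    unfold oracleBound
    fun_prop
  exact (isCompact_stdSimplex ℝ (Fin B)).exists_isMinOn ⟨_, single_mem_stdSimplex ℝ 0⟩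
    hc.continuousOn

end IsGaussianModel

end Oracle

end QAggregation

theorem mainTheorem1 :
    ∃ C : ℝ, 0 < C ∧
      ∀ (d B : ℕ) [NeZero B] (N : Fin B → ℕ) (μ : Fin B → EuclideanSpace ℝ (Fin d))
        (S : Fin B → Matrix (Fin d) (Fin d) ℝ)
        (Ω : Type*) [MeasurableSpace Ω] (P : Measure Ω) [IsProbabilityMeasure P]
        (X : (k : Fin B) → Fin (N k) → Ω → EuclideanSpace ℝ (Fin d))
        (u₀ : ℝ) (wHat : Ω → Fin B → ℝ),
        (∀ k, 0 < N k) →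
        (∀ k, (S k).PosSemidef) →
        S 0 ≠ 0 →
        (∀ k i, HasLaw (X k i) (multivariateGaussian (μ k) (S k)) P) →
        iIndepFun (fun p : (k : Fin B) × Fin (N k) => X p.1 p.2) P →
        Real.log (17 * (B : ℝ)) ≤ u₀ →
        u₀ ≤ ((N 0 : ℝ) - 1) / 2 →
        AEMeasurable wHat P →
        (∀ᵐ a ∂P, QAggregation.IsQAggregationWeight u₀ (fun k i => X k i a) (wHat a)) →
        Integrable
          (fun a => ‖QAggregation.aggregate (fun k i => X k i a) (wHat a) - μ 0‖ ^ 2) P ∧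
        ∃ wStar ∈ stdSimplex ℝ (Fin B),
          IsMinOn (QAggregation.oracleBound P X μ S C u₀) (stdSimplex ℝ (Fin B)) wStar ∧
          QAggregation.aggRisk P X (μ 0) wHat / QAggregation.naiveRisk P X (μ 0)
            ≤ 1 / QAggregation.naiveRisk P X (μ 0) * QAggregation.oracleBound P X μ S C u₀ wStar
              + C * (u₀ / √(QAggregation.effDim (S 0))) := by
  -- the constant of the remainder term in `aggRisk_le`; the other two constants are smaller
  refine ⟨116, by norm_num, ?_⟩
  intro d B _ N μ S Ω _ P _ X u wHat hN hS hS0 hX hind hu huN hwm hwHat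
  have hB : (1 : ℝ) ≤ B := by exact_mod_cast Nat.one_le_iff_ne_zero.2 (NeZero.ne B)
  have hu0 : 0 < u := (Real.log_pos (by linarith)).trans_le hu
  have h : QAggregation.IsGaussianModel P X μ S := by
    refine ⟨hN, ?_, fun k => ⟨hS k, hX k, ?_⟩, hind⟩
    · have : (1 : ℝ) < N 0 := by linarith
      exact_mod_cast this
    · exact hind.precomp (g := fun i => (⟨k, i⟩ : (k : Fin B) × Fin (N k)))
        fun i j hij => by simpa using hij
  obtain ⟨w, hw, hmin⟩ := h.exists_isMinOn_oracleBound 116 u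
  obtain ⟨hint, hle⟩ := h.aggRisk_le hu huN hwm hwHat hw
  refine ⟨hint, w, hw, hmin, ?_⟩
  have hN0 : (0 : ℝ) < N 0 := by exact_mod_cast hN 0
  have htr : 0 < (S 0).trace :=
    lt_of_le_of_ne (hS 0).trace_nonneg fun h0 => hS0 ((hS 0).trace_eq_zero_iff.1 h0.symm)
  have heff : u / √(QAggregation.effDim (S 0))
      = u * √((S 0 * S 0).trace) / (S 0).trace := by
    rw [QAggregation.effDim, Real.sqrt_div (by positivity), Real.sqrt_sq htr.le, div_div_eq_mul_div]
  have hR0 : 0 ≤ QAggregation.aggRisk P X (μ 0) fun _ => w := integral_nonneg fun _ => sq_nonneg _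
  have hexp : Real.exp (-u) ≤ Real.exp (-u / 2) := Real.exp_le_exp.2 (by linarith)
  have hp0 : 0 ≤ QAggregation.penalty N μ S w * √u := mul_nonneg
    (Finset.sum_nonneg fun k _ => mul_nonneg (hw.1 k) (Real.sqrt_nonneg _)) (Real.sqrt_nonneg _)
  have hbound : QAggregation.aggRisk P X (μ 0) wHat
      ≤ QAggregation.oracleBound P X μ S 116 u w
        + 116 * (u * (√((S 0 * S 0).trace) / N 0)) := by
    have h1 : 2 * (B : ℝ) * Real.exp (-u) ≤ 116 * B * Real.exp (-u / 2) := by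
      have := mul_le_mul_of_nonneg_left hexp (zero_le_one.trans hB)
      have : 0 ≤ (B : ℝ) * Real.exp (-u / 2) := by positivity
      linarith
    have h2 := mul_le_mul_of_nonneg_left h1 hR0
    rw [QAggregation.oracleBound]
    linarith
  rw [h.naiveRisk_eq, heff, div_le_iff₀ (by positivity)]
  refine hbound.trans (le_of_eq ?_)
  field_simp
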